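/- Let $(A,|\cdot|_{\mathrm{Ban}})$ be a Banach ring (a nonzero commutative ring, complete with respect to a submultiplicative norm) that is an integral domain. An $A$-variety is an integral scheme that is separated, of finite type and flat over $\operatorname{Spec} A$. For an $A$-scheme $X$ of finite type, $X^{\mathrm{an}}$ is its Berkovich analytification: its points $y$ are pairs of a point $\iota(y)\in X$ and an absolute value $|\cdot|_y$ on the residue field $\kappa(\iota(y))$ whose restriction to $A$ is bounded by $|\cdot|_{\mathrm{Ban}}$. It has the coarsest topology for which $U^{\mathrm{an}}$ is open for $U\subseteq X$ open and $y\mapsto |f(y)|$ is continuous on $U^{\mathrm{an}}$ for all $f\in\mathcal O(U)$. Let $\mathscr M(A)$ be the set of multiplicative seminorms on $A$ bounded by $|\cdot|_{\mathrm{Ban}}$, with the structure map $X^{\mathrm{an}}\to\mathscr M(A)$, and let $\mathscr H_y$ be the completion of $\kappa(\iota(y))$ for $|\cdot|_y$. Let $L$ be a line bundle on $X$. A metric $\phi=-\log\|\cdot\|$ on $L^{\mathrm{an}}$ is a family of norms, compatible with $|\cdot|_y$, on the $\mathscr H_y$-lines $L^{\mathrm{an}}_y=L(\iota(y))\otimes_{\kappa(\iota(y))}\mathscr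 H_y$, $y\in X^{\mathrm{an}}$. It is continuous if $y\mapsto\|s(y)\|$ is continuous on $U^{\mathrm{an}}$ for every section $s$ of $L$ over an open $U\subseteq X$. A singular metric is in addition allowed to be identically $-\infty$ on some of the lines. A tropical Fubini–Study metric on $L^{\mathrm{an}}$ is a continuous metric of the form $\phi=m^{-1}\max_{j}(\log|s_j|+\lambda_j)$, where $m\ge 1$, $(s_j)$ is a finite family of global sections of $mL$ without common zeros, and $\lambda_j\in\mathbb R$; that is, $\phi(v)=m^{-1}\max_j(\log|s_j(y)/v^{\otimes m}|_y+\lambda_j)$ for $0\ne v\in L^{\mathrm{an}}_y$. On a $\mathbb Q$-line bundle $\frac1n M$, with $M$ a line bundle and $n\ge 1$, a metric is $n^{-1}\Phi$ for a metric $\Phi$ on $M$, and it is tropical Fubini–Study if $\Phi$ is. * A metric $\phi$ on $L^{\mathrm{an}}$ is continuous plurisubharmonic if it is continuous, it is the pointwise limit of a decreasing net of tropical Fubini–Study metrics on $L^{\mathrm{an}}$, and, for every $x\in\mathscr M(A)$ with kernel $(0)$, $\phi$ is not identically $-\infty$ on the fibre of $X^{\mathrm{an}}$ over $x$. * A metric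 $\phi$ on $L^{\mathrm{an}}$ is continuous semipositive if there are a net of projective $A$-models $(X_i,L_i)$ of $(X,L)$ (an open immersion over $A$ of $X$ into a projective $A$-variety $X_i$ and a $\mathbb Q$-line bundle $L_i$ on $X_i$ with an isomorphism $L_i|_X\cong L$ of $\mathbb Q$-line bundles) and tropical Fubini–Study metrics $\phi_i$ on $L_i^{\mathrm{an}}$ whose restrictions to $X^{\mathrm{an}}$ converge to $\phi$ uniformly on every compact subset of $X^{\mathrm{an}}$. **Theorem.** Let $X$ be a projective $A$-variety and $L$ a line bundle on $X$. A metric $\phi$ on $L^{\mathrm{an}}$ is continuous semipositive if and only if it is continuous plurisubharmonic. -/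

import Mathlib

open CategoryTheory AlgebraicGeometry Opposite TopologicalSpace
open scoped TensorProduct

universe u

noncomputable section

namespace BerkovichPSH

/-! ### Varieties and projective morphisms over an affine base -/

section Varieties

variable {A : Type u} [CommRing A]

/-- An `A`-variety: an integral scheme, separated, of finite type and flat over `Spec A`. -/
structure IsVariety {X : Scheme.{u}} (π : X ⟶ Spec (CommRingCat.of A)) : Prop where
  isIntegral : IsIntegral X
  isSeparated : IsSeparated π
  locallyOfFiniteType : LocallyOfFiniteType π
  quasiCompact : QuasiCompact π
  flat : Flat π

variable (A) in
/-- The projective space `ℙⁿ` over `A`, that is `Proj A[T₀, …, Tₙ]`. -/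
def ProjSpace (n : ℕ) : Scheme.{u} :=
  letI := MvPolynomial.gradedAlgebra (σ := Fin (n + 1)) (R := A)
  Proj (MvPolynomial.homogeneousSubmodule (Fin (n + 1)) A)

variable (A) in
/-- The structure morphism `ℙⁿ ⟶ Spec A`. -/
def ProjSpace.toSpec (n : ℕ) : ProjSpace A n ⟶ Spec (CommRingCat.of A) :=
  letI := MvPolynomial.gradedAlgebra (σ := Fin (n + 1)) (R := A)
  Proj.toSpecZero (MvPolynomial.homogeneousSubmodule (Fin (n + 1)) A) ≫
    Spec.map (CommRingCat.ofHom
      (algebraMap A (MvPolynomial.homogeneousSubmodule (Fin (n + 1)) A 0)))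

/-- `X` is projective over `Spec A`: it is isomorphic over `A` to a closed subscheme of some `ℙⁿ`.
(Over an affine base this is the same as being a closed subscheme of `ℙ(E)` for a quasi-coherent
module `E` of finite type, since such an `E` is a quotient of a finite free module.) -/
def IsProjective {X : Scheme.{u}} (π : X ⟶ Spec (CommRingCat.of A)) : Prop :=
  ∃ (n : ℕ) (i : X ⟶ ProjSpace A n), IsClosedImmersion i ∧ i ≫ ProjSpace.toSpec A n = π

end Varieties

/-! ### Line bundles and their tensor powers -/

section LineBundles

variable {X : Scheme.{u}}

/-- A generator (local frame) `e` of the module `L` over the open set `U`: the map `f ↦ f • e`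
is an isomorphism from `𝒪` to `L` over `U`. -/
def IsFrame (L : X.Modules) {U : X.Opens} (e : Γ(L, U)) : Prop :=
  ∀ (V : X.Opens) (h : V ≤ U),
    Function.Bijective fun f : Γ(X, V) ↦ f • (L.presheaf.map (homOfLE h).op e : Γ(L, V))

/-- A line bundle: a sheaf of modules that is locally free of rank one. -/
def IsLineBundle (L : X.Modules) : Prop :=
  ∀ p : X, ∃ (U : X.Opens) (_ : p ∈ U) (e : Γ(L, U)), IsFrame L e

/-- The tensor powers of a presheaf of modules: `U ↦ P(U)^{⊗ n}`. -/
def presheafPow (P : PresheafOfModules.{u} (X.presheaf ⋙ forget₂ CommRingCat RingCat)) :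
    ℕ → PresheafOfModules.{u} (X.presheaf ⋙ forget₂ CommRingCat RingCat)
  | 0 => MonoidalCategory.tensorUnit _
  | n + 1 => MonoidalCategory.tensorObj (presheafPow P n) P

/-- The pure tensor `s ⊗ ⋯ ⊗ s` in `P(U)^{⊗ n}`. -/
def presheafPowSection (P : PresheafOfModules.{u} (X.presheaf ⋙ forget₂ CommRingCat RingCat))
    {U : X.Opens} (s : P.obj (op U)) : (n : ℕ) → (presheafPow P n).obj (op U)
  | 0 => (1 : Γ(X, U))
  | n + 1 => presheafPowSection P s n ⊗ₜ[Γ(X, U)] s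

/-- The tensor power `L^{⊗ n}` (written `nL` additively): the sheaf of modules associated to the
presheaf `U ↦ L(U)^{⊗ n}`. -/
def tensorPow (L : X.Modules) (n : ℕ) : X.Modules :=
  (PresheafOfModules.sheafification (𝟙 X.ringCatSheaf.obj)).obj (presheafPow L.val n)

/-- The section `s^{⊗ n}` of `L^{⊗ n}` defined by a section `s` of `L`. -/
def tensorPowSection (L : X.Modules) {U : X.Opens} (s : Γ(L, U)) (n : ℕ) : Γ(tensorPow L n, U) :=
  (((PresheafOfModules.sheafificationAdjunction (𝟙 X.ringCatSheaf.obj)).unit.app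
    (presheafPow L.val n)).app (op U)).hom (presheafPowSection L.val s n)

/-- The stalk of a sheaf of modules is a module over the local ring. -/
instance stalkModule (L : X.Modules) (p : X) :
    Module (X.presheaf.stalk p) (↑(TopCat.Presheaf.stalk L.presheaf p) : Type u) :=
  PresheafOfModules.instModuleCarrierStalkCommRingCatCarrierAbPresheafOpensCarrier
    (R := X.presheaf) L.val p

instance residueFieldAlgebra (p : X) : Algebra (X.presheaf.stalk p) (X.residueField p) :=
  inferInstanceAs (Algebra (X.presheaf.stalk p) (IsLocalRing.ResidueField (X.presheaf.stalk p)))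

/-- The fibre `L(p) = L_p ⊗ κ(p)` of `L` at a point `p` of `X`. -/
abbrev Fiber (L : X.Modules) (p : X) : Type u :=
  X.residueField p ⊗[X.presheaf.stalk p] (↑(TopCat.Presheaf.stalk L.presheaf p) : Type u)

/-- The value `s(p)` in the fibre `L(p)` of a section `s` of `L` over `U ∋ p`. -/
def evalFiber (L : X.Modules) {U : X.Opens} (s : Γ(L, U)) (p : X) (hp : p ∈ U) : Fiber L p :=
  (1 : X.residueField p) ⊗ₜ[X.presheaf.stalk p] (TopCat.Presheaf.germ L.presheaf U p hp s)

/-- A `ℚ`-line bundle `(1/n) M`, for a line bundle `M` and an integer `n ≥ 1`. Every element of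
`Pic(X) ⊗ ℚ` is of this form. -/
structure QLineBundle (X : Scheme.{u}) where
  bundle : X.Modules
  isLineBundle : IsLineBundle bundle
  denom : ℕ
  denom_pos : 0 < denom

end LineBundles

/-! ### Berkovich analytification -/

section Analytification

variable {A : Type u} [NormedCommRing A]

variable (A) in
/-- The Berkovich spectrum of the Banach ring `A`: the multiplicative seminorms on `A` that are
bounded by the given norm. -/
def BerkovichSpectrum : Type u := {x : MulRingSeminorm A // ∀ a, x a ≤ ‖a‖}

/-- A point of the Berkovich spectrum is Zariski dense if its kernel is the zero ideal. -/
def BerkovichSpectrum.IsZariskiDense (x : BerkovichSpectrum A) : Prop :=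
  ∀ a : A, x.1 a = 0 → a = 0

/-- The ring homomorphism `A → κ(p)`, for a point `p` of an `A`-scheme. -/
def toResidueField {X : Scheme.{u}} (π : X ⟶ Spec (CommRingCat.of A)) (p : X) :
    A →+* X.residueField p :=
  ((Scheme.ΓSpecIso (CommRingCat.of A)).inv ≫ π.appTop ≫ X.Γevaluation p).hom

/-- The analytification `X^an` of an `A`-scheme `X`. A point is a point `pt` of `X`, its image
under the kernel map, with an absolute value on `κ(pt)` whose restriction to `A` is bounded by the
norm of `A`. Over an affine open `Spec R` these are the multiplicative seminorms on `R` whose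
restriction to `A` is bounded. -/
@[ext]
structure An {X : Scheme.{u}} (π : X ⟶ Spec (CommRingCat.of A)) where
  pt : X
  val : AbsoluteValue (X.residueField pt) ℝ
  bounded : ∀ a : A, val (toResidueField π pt a) ≤ ‖a‖

namespace An

variable {X Y : Scheme.{u}} {π : X ⟶ Spec (CommRingCat.of A)} {ρ : Y ⟶ Spec (CommRingCat.of A)}

/-- The value `|f(y)|` of a regular function `f` on `U ⊆ X` at a point `y` of `U^an`. -/
def absVal (y : An π) {U : X.Opens} (hy : y.pt ∈ U) (f : Γ(X, U)) : ℝ :=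
  y.val (X.evaluation U y.pt hy f)

/-- The topology of `X^an`: the coarsest one for which `U^an` is open for `U` open in `X` and
`y ↦ |f(y)|` is continuous on `U^an` for every regular function `f` on `U`. Over an affine open
`Spec R` it is the topology of pointwise convergence on `R`. -/
instance : TopologicalSpace (An π) :=
  TopologicalSpace.generateFrom
    {S | ∃ (U : X.Opens) (f : Γ(X, U)) (W : Set ℝ), IsOpen W ∧
      S = {y : An π | ∃ hy : y.pt ∈ U, y.absVal hy f ∈ W}}

/-- The structure map from `X^an` to the Berkovich spectrum of `A`. -/
def structureMap (y : An π) : BerkovichSpectrum A :=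
  ⟨{ toFun := fun a ↦ y.val (toResidueField π y.pt a)
     map_zero' := by simp
     map_one' := by simp
     map_mul' := by simp
     neg' := by simp
     add_le' := fun a b ↦ by simpa using y.val.add_le _ _ }, y.bounded⟩

/-- The map `X^an → Y^an` induced by a morphism `g : X ⟶ Y` over `A`. -/
def map (g : X ⟶ Y) (hg : g ≫ ρ = π) (y : An π) : An ρ where
  pt := g y.pt
  val := y.val.comp (f := (g.residueFieldMap y.pt).hom) (RingHom.injective _)
  bounded a := by
    have h : (g.residueFieldMap y.pt).hom (toResidueField ρ (g y.pt) a) =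
        toResidueField π y.pt a := by
      subst hg
      have := congr($(Scheme.Γevaluation_naturality g y.pt).hom
        (ρ.appTop.hom ((Scheme.ΓSpecIso (CommRingCat.of A)).inv.hom a)))
      exact this
    have := y.bounded a
    rw [← h] at this
    exact this

/-- The completed residue field `ℋ_y` at a point `y` of `X^an`. -/
abbrev ResField (y : An π) : Type u := y.val.Completion

/-- The fibre `L^an_y = L(ι(y)) ⊗ ℋ_y` at `y` of the analytification of `L`. -/
abbrev Fib (L : X.Modules) (y : An π) : Type u :=
  y.ResField ⊗[X.residueField y.pt] Fiber L y.pt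

/-- The value `s(y)` in `L^an_y` of a section `s` of `L` over `U`, at a point `y` of `U^an`. -/
def eval {L : X.Modules} {U : X.Opens} (s : Γ(L, U)) (y : An π) (hy : y.pt ∈ U) : y.Fib L :=
  (1 : y.ResField) ⊗ₜ[X.residueField y.pt] evalFiber L s y.pt hy

/-- `w = v^{⊗ m}`, for `v` in `L^an_y` and `w` in `(L^{⊗ m})^an_y`: if `v = a e(y)` for a local
frame `e` of `L`, then `w = a ^ m e^{⊗ m}(y)`. -/
def IsTensorPower {L : X.Modules} (m : ℕ) (y : An π) (v : y.Fib L) (w : y.Fib (tensorPow L m)) :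
    Prop :=
  ∃ (U : X.Opens) (hy : y.pt ∈ U) (e : Γ(L, U)) (a : y.ResField), IsFrame L e ∧
    v = a • y.eval e hy ∧ w = a ^ m • y.eval (tensorPowSection L e m) hy

end An

/-! ### Metrics -/

section Metrics

variable {X : Scheme.{u}} (π : X ⟶ Spec (CommRingCat.of A))

/-- A function on the line `L^an_y` which is a norm compatible with the absolute value of `ℋ_y`.
(The triangle inequality follows, as the line is one-dimensional.) -/
def IsLineNorm {L : X.Modules} (y : An π) (N : y.Fib L → ℝ) : Prop :=
  (∀ v, v ≠ 0 → 0 < N v) ∧ ∀ (a : y.ResField) (v : y.Fib L), N (a • v) = ‖a‖ * N v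

/-- A metric on `L` over `X^an`: a norm on each line `L^an_y`. -/
structure Metric (L : X.Modules) where
  norm : ∀ y : An π, y.Fib L → ℝ
  isLineNorm : ∀ y, IsLineNorm π y (norm y)

/-- A singular metric on `L`, in additive notation: a function on the nonzero vectors of `L^an`
with values in `ℝ ∪ {-∞}` that on each line is identically `-∞` or of the form `-log ‖·‖`.
(The values of `weight` at zero vectors carry no information.) -/
structure SingularMetric (L : X.Modules) where
  weight : ∀ y : An π, y.Fib L → EReal
  dichotomy : ∀ y, (∀ v, v ≠ 0 → weight y v = ⊥) ∨
    ∃ N : y.Fib L → ℝ, IsLineNorm π y N ∧ ∀ v, v ≠ 0 → weight y v = ((-Real.log (N v) : ℝ) : EReal)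

variable {π} {L : X.Modules}

/-- A metric in additive notation, `φ = -log ‖·‖`, as a singular metric. -/
def Metric.toSingular (φ : Metric π L) : SingularMetric π L where
  weight y v := ((-Real.log (φ.norm y v) : ℝ) : EReal)
  dichotomy y := Or.inr ⟨φ.norm y, φ.isLineNorm y, fun _ _ ↦ rfl⟩

/-- A metric is continuous if for every section `s` of `L` on an open subset `U` of `X`,
`y ↦ ‖s(y)‖` is continuous on `U^an`. -/
def Metric.IsContinuous (φ : Metric π L) : Prop :=
  ∀ (U : X.Opens) (s : Γ(L, U)),
    Continuous fun y : {y : An π // y.pt ∈ U} ↦ φ.norm y.1 (y.1.eval s y.2)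

/-- The weight of the singular metric `log |s|` on `N` given by a global section `s` of `N`:
at a nonzero `w` in `N^an_y` it is `-log |w / s(y)| = log |c|`, where `s(y) = c w` (such a `c`
exists and is unique if `N` is a line bundle), and `-∞` if `s(y) = 0`. -/
def logAbs {N : X.Modules} (s : Γ(N, ⊤)) (y : An π) (w : y.Fib N) : EReal :=
  ⨆ (c : y.ResField) (_ : c • w = y.eval s (by trivial)), ENNReal.log ‖c‖ₑ

/-- A tropical Fubini–Study metric on `L`: a continuous metric of the form
`φ = m⁻¹ max_j (log |s_j| + λ_j)` with `m ≥ 1`, finitely many sections `s_j` of `mL` without common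
zeros and real numbers `λ_j`. The value at a nonzero `v` in `L^an_y` of the metric `m⁻¹ Φ` on `L`
given by a metric `Φ` on `mL` is `m⁻¹ Φ(v^{⊗ m})`. -/
def Metric.IsTropicalFS (φ : Metric π L) : Prop :=
  φ.IsContinuous ∧
  ∃ (m : ℕ) (k : ℕ) (s : Fin k → Γ(tensorPow L m, ⊤)) (l : Fin k → ℝ), 0 < m ∧
    (∀ p : X, ∃ j, evalFiber (tensorPow L m) (s j) p (by trivial) ≠ 0) ∧
    ∀ (y : An π) (v : y.Fib L) (w : y.Fib (tensorPow L m)), v ≠ 0 → y.IsTensorPower m v w →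
      φ.toSingular.weight y v =
        (((m : ℝ)⁻¹ : ℝ) : EReal) * ⨆ j, (logAbs (s j) y w + ((l j : ℝ) : EReal))

/-- A plurisubharmonic metric: a singular metric that is the pointwise limit of a decreasing net of
tropical Fubini–Study metrics and that is not identically `-∞` on the fibre of `X^an` over any
Zariski dense point `x` of the Berkovich spectrum of `A`. -/
def SingularMetric.IsPSH (φ : SingularMetric π L) : Prop :=
  (∃ (I : Type u) (_ : Preorder I) (_ : IsDirectedOrder I) (_ : Nonempty I) (ψ : I → Metric π L),
    (∀ i, (ψ i).IsTropicalFS) ∧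
    (∀ i j, i ≤ j → ∀ (y : An π) (v : y.Fib L), v ≠ 0 →
      (ψ j).toSingular.weight y v ≤ (ψ i).toSingular.weight y v) ∧
    ∀ (y : An π) (v : y.Fib L), v ≠ 0 →
      Filter.Tendsto (fun i ↦ (ψ i).toSingular.weight y v) Filter.atTop (nhds (φ.weight y v))) ∧
  ∀ x : BerkovichSpectrum A, x.IsZariskiDense →
    ∃ (y : An π) (v : y.Fib L), y.structureMap = x ∧ v ≠ 0 ∧ φ.weight y v ≠ ⊥

/-- A metric is continuous plurisubharmonic if it is continuous and plurisubharmonic. -/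
def Metric.IsContinuousPSH (φ : Metric π L) : Prop :=
  φ.IsContinuous ∧ φ.toSingular.IsPSH

end Metrics

/-! ### Projective models and continuous semipositive metrics -/

section Semipositive

variable {U : Scheme.{u}}

/-- A projective `A`-model `(X, L')` of `(U, L)`: an open immersion over `A` of `U` into a
projective `A`-variety `X`, and a `ℚ`-line bundle `L' = (1/n) M` on `X` together with an
isomorphism `L'|_U ≅ L` of `ℚ`-line bundles, that is, an isomorphism `M|_U ≅ L^{⊗ n}`. (If the
isomorphism is given only after raising to a power `k`, write `L' = (1/kn) M^{⊗ k}`.) -/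
structure ProjectiveModel (π : U ⟶ Spec (CommRingCat.of A)) (L : U.Modules) where
  X : Scheme.{u}
  toSpec : X ⟶ Spec (CommRingCat.of A)
  isVariety : IsVariety toSpec
  isProjective : IsProjective toSpec
  emb : U ⟶ X
  isOpenImmersion : IsOpenImmersion emb
  emb_toSpec : emb ≫ toSpec = π
  qBundle : QLineBundle X
  iso : qBundle.bundle.restrict emb ≅ tensorPow L qBundle.denom

variable {π : U ⟶ Spec (CommRingCat.of A)} {L : U.Modules}

namespace ProjectiveModel

attribute [instance] ProjectiveModel.isOpenImmersion

variable (M : ProjectiveModel π L)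

/-- For a section `s` of `L` on `V ⊆ U`, the section of `M` on the image of `V` in `X` that
corresponds to `s^{⊗ n}` under `M|_U ≅ L^{⊗ n}`. -/
def powSection {V : U.Opens} (s : Γ(L, V)) : Γ(M.qBundle.bundle, M.emb ''ᵁ V) :=
  (M.qBundle.bundle.restrictAppIso M.emb V).hom
    (M.iso.inv.app V (tensorPowSection L s M.qBundle.denom))

/-- The map `U^an → X^an`. -/
def anMap (y : An π) : An M.toSpec := y.map M.emb M.emb_toSpec

/-- A metric on the `ℚ`-line bundle `L' = (1/n) M` is written `n⁻¹ Φ` with `Φ` a metric on `M`.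
This says that the metric `ψ` on `L` over `U^an` is the restriction of `n⁻¹ Φ` via the isomorphism
`L'|_U ≅ L`: one has `ψ(e(y)) = n⁻¹ Φ(e^{⊗ n}(y))` for every local frame `e` of `L`. -/
def IsRestriction (Φ : Metric M.toSpec M.qBundle.bundle) (ψ : Metric π L) : Prop :=
  ∀ (V : U.Opens) (e : Γ(L, V)), IsFrame L e → ∀ (y : An π) (hy : y.pt ∈ V),
    -Real.log (ψ.norm y (y.eval e hy)) =
      (M.qBundle.denom : ℝ)⁻¹ * -Real.log (Φ.norm (M.anMap y)
        ((M.anMap y).eval (M.powSection e) (Set.mem_image_of_mem _ hy)))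

end ProjectiveModel

/-- A net of metrics `ψ_i` on `L` converges compactly to `φ`: on each compact subset of `U^an` the
functions `ψ_i - φ` converge uniformly to zero. -/
def CompactlyConverges {I : Type u} [Preorder I] (ψ : I → Metric π L) (φ : Metric π L) : Prop :=
  ∀ K : Set (An π), IsCompact K → ∀ ε : ℝ, 0 < ε → ∃ i₀, ∀ i, i₀ ≤ i →
    ∀ y ∈ K, ∀ v : y.Fib L, v ≠ 0 →
      |(-Real.log ((ψ i).norm y v)) - (-Real.log (φ.norm y v))| < ε

/-- A metric `φ` on `L` over `U^an` is continuous semipositive if there is a net of projective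
models `(X_i, L_i)` of `(U, L)` and tropical Fubini–Study metrics `φ_i` on `L_i` whose restrictions
to `U^an` converge compactly to `φ`. A tropical Fubini–Study metric on `L_i = (1/n) M` is `n⁻¹` times
one on the line bundle `M`. -/
def Metric.IsContinuousSemipositive (φ : Metric π L) : Prop :=
  ∃ (I : Type u) (_ : Preorder I) (_ : IsDirectedOrder I) (_ : Nonempty I)
    (M : I → ProjectiveModel π L)
    (Φ : ∀ i, Metric (M i).toSpec (M i).qBundle.bundle) (ψ : I → Metric π L),
    (∀ i, (Φ i).IsTropicalFS) ∧ (∀ i, (M i).IsRestriction (Φ i) (ψ i)) ∧ CompactlyConverges ψ φ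

end Semipositive

end Analytification

end BerkovichPSH

end

/-! Over a projective variety both notions say that the metric is a uniform limit of tropical
Fubini–Study metrics. The analytification is compact, so compact convergence is uniform convergence,
and a tropical Fubini–Study metric stays one after adding a real constant.

From plurisubharmonic to semipositive, the variety serves as its own model, with denominator 1. The
differences between the metrics of the decreasing net and the limit are continuous functions
decreasing to zero, so Dini's theorem makes the convergence uniform on compact sets
(`compactlyConverges_of_antitone`).

Conversely, a Fubini–Study metric on a model `(1/n) M` defined by sections of `mM` restricts to one
defined by sections of `nmL` (`ProjectiveModel.exists_section`, `IsRestriction.isTropicalFS_shift`).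
By compactness (`IsProjective.compactSpace`) the restrictions approximate the given metric
uniformly, so it is continuous. A subsequence with geometric errors, shifted by slightly larger
geometric constants, decreases to it.

It remains to see that the limit is not identically `-∞` over a Zariski dense point. Being a genuine
metric, it is finite everywhere, so the question is whether the fibre is nonempty
(`IsVariety.exists_structureMap_eq`). By flatness the generic fibre is nonempty and has a closed
point, whose residue field is finite over `Frac A`. The absolute value extends there by
`exists_absoluteValue_extension`, proved for archimedean and nonarchimedean values alike by
Berkovich's argument that a minimal algebra seminorm on a field is multiplicative. -/

noncomputable section

namespace BerkovichPSH

/-! ### Extension of absolute values to finite field extensions -/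

section AbsExt

open Polynomial

variable {K L : Type*} [Field K] [Field L] [Algebra K L]

/-- A nonzero submultiplicative seminorm on the `K`-algebra `L`, compatible with the absolute
value `v` of `K`. -/
structure IsAlgSeminorm (v : AbsoluteValue K ℝ) (p : L → ℝ) : Prop where
  nonneg : ∀ x, 0 ≤ p x
  one : 1 ≤ p 1
  add : ∀ x y, p (x + y) ≤ p x + p y
  mul : ∀ x y, p (x * y) ≤ p x * p y
  smul : ∀ a x, p (a • x) ≤ v a * p x

namespace IsAlgSeminorm

variable {v : AbsoluteValue K ℝ} {p : L → ℝ} (hp : IsAlgSeminorm v p)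
include hp

lemma zero : p 0 = 0 :=
  le_antisymm (by simpa using hp.smul 0 0) (hp.nonneg 0)

lemma neg (x : L) : p (-x) ≤ p x := by
  simpa using hp.smul (-1) x

lemma sum_le {ι : Type*} (s : Finset ι) (g : ι → L) : p (∑ i ∈ s, g i) ≤ ∑ i ∈ s, p (g i) :=
  Finset.le_sum_of_subadditive p hp.zero.le hp.add s g

end IsAlgSeminorm

/-- The sum norm in a basis is submultiplicative up to a constant depending on the structure
constants, and rescaling absorbs that constant. -/
lemma exists_isAlgSeminorm [FiniteDimensional K L] (v : AbsoluteValue K ℝ) :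
    ∃ p : L → ℝ, IsAlgSeminorm v p := by
  classical
  let b := Module.finBasis K L
  set n := Module.finrank K L
  set N : L → ℝ := fun x ↦ ∑ i, v (b.repr x i) with hN
  have hN0 : ∀ x, 0 ≤ N x := fun x ↦ Finset.sum_nonneg fun i _ ↦ v.nonneg _
  have hNadd : ∀ x y, N (x + y) ≤ N x + N y := fun x y ↦ by
    rw [hN]
    simp only [map_add, Finsupp.add_apply, ← Finset.sum_add_distrib]
    exact Finset.sum_le_sum fun i _ ↦ v.add_le _ _
  have hNsmul : ∀ a x, N (a • x) = v a * N x := fun a x ↦ by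
    simp [hN, Finset.mul_sum]
  have hN1 : 0 < N 1 := by
    refine (hN0 1).lt_of_ne fun h ↦ one_ne_zero (α := L) ?_
    have := (Finset.sum_eq_zero_iff_of_nonneg (fun i _ ↦ v.nonneg _)).mp h.symm
    exact b.repr.map_eq_zero_iff.mp (Finsupp.ext fun i ↦ by simpa using this i (by simp))
  have hNsum : ∀ (s : Finset (Fin n)) (g : Fin n → L), N (∑ i ∈ s, g i) ≤ ∑ i ∈ s, N (g i) :=
    fun s g ↦ Finset.le_sum_of_subadditive N (by simp [hN]) hNadd s g
  set D : ℝ := ∑ i, ∑ j, N (b i * b j)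
  have hD : ∀ i j, N (b i * b j) ≤ D := fun i j ↦
    (Finset.single_le_sum (f := fun j ↦ N (b i * b j)) (fun _ _ ↦ hN0 _) (Finset.mem_univ j)).trans
      (Finset.single_le_sum (f := fun i ↦ ∑ j, N (b i * b j))
        (fun _ _ ↦ Finset.sum_nonneg fun _ _ ↦ hN0 _) (Finset.mem_univ i))
  have hNmul : ∀ x y, N (x * y) ≤ D * (N x * N y) := fun x y ↦ by
    have hxy : x * y = ∑ i, ∑ j, (b.repr x i * b.repr y j) • (b i * b j) := by
      conv_lhs => rw [← b.sum_repr x, ← b.sum_repr y, Finset.sum_mul_sum]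
      simp_rw [smul_mul_smul_comm]
    rw [hxy]
    calc N (∑ i, ∑ j, (b.repr x i * b.repr y j) • (b i * b j))
        ≤ ∑ i, ∑ j, v (b.repr x i) * v (b.repr y j) * D := by
          refine (hNsum _ _).trans (Finset.sum_le_sum fun i _ ↦ (hNsum _ _).trans
            (Finset.sum_le_sum fun j _ ↦ ?_))
          rw [hNsmul, map_mul]
          exact mul_le_mul_of_nonneg_left (hD i j) (by positivity)
      _ = D * (N x * N y) := by
          simp_rw [hN, Finset.sum_mul_sum, Finset.mul_sum, mul_comm D]
  -- `C ≥ D` makes `C * N` submultiplicative, and `C ≥ (N 1)⁻¹` gives the value at least 1 at the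
  -- unit.
  set C : ℝ := max D (N 1)⁻¹
  have hC : 0 < C := lt_max_of_lt_right (inv_pos.mpr hN1)
  refine ⟨fun x ↦ C * N x, fun x ↦ mul_nonneg hC.le (hN0 x), ?_, fun x y ↦ ?_, fun x y ↦ ?_,
    fun a x ↦ ?_⟩
  · rw [← inv_mul_cancel₀ hN1.ne']
    exact mul_le_mul_of_nonneg_right (le_max_right _ _) hN1.le
  · rw [← mul_add]; exact mul_le_mul_of_nonneg_left (hNadd x y) hC.le
  · calc C * N (x * y) ≤ C * (D * (N x * N y)) := mul_le_mul_of_nonneg_left (hNmul x y) hC.le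
      _ ≤ C * (C * (N x * N y)) := mul_le_mul_of_nonneg_left (mul_le_mul_of_nonneg_right
          (le_max_left _ _) (mul_nonneg (hN0 x) (hN0 y))) hC.le
      _ = _ := by ring
  · exact (by rw [hNsmul]; ring : C * N (a • x) = v a * (C * N x)).le

/-- Zorn's lemma, with pointwise infima as lower bounds of chains. Two members of a chain have a
common lower one, which lets sums and products pass to the infimum. The condition `1 ≤ p 1` survives
infima and keeps them from vanishing. -/
lemma exists_minimal_isAlgSeminorm [FiniteDimensional K L] (v : AbsoluteValue K ℝ) :
    ∃ p : L → ℝ, IsAlgSeminorm v p ∧ ∀ q : L → ℝ, IsAlgSeminorm v q → q ≤ p → p ≤ q := by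
  obtain ⟨p₀, hp₀⟩ := exists_isAlgSeminorm (L := L) v
  suffices h : ∀ c ⊆ {p : (L → ℝ)ᵒᵈ | IsAlgSeminorm v p.ofDual}, IsChain (· ≤ ·) c → ∀ y ∈ c,
      ∃ q ∈ {p : (L → ℝ)ᵒᵈ | IsAlgSeminorm v p.ofDual}, ∀ p ∈ c, p ≤ q by
    obtain ⟨m, -, hm⟩ := zorn_le_nonempty₀ _ h (OrderDual.toDual p₀) hp₀
    exact ⟨m.ofDual, hm.prop, fun q hq hqm ↦ hm.le_of_ge (y := OrderDual.toDual q) hq hqm⟩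
  intro c hc' hchain y hy
  have hc : ∀ p ∈ c, IsAlgSeminorm v p.ofDual := fun p hp ↦ hc' hp
  have : Nonempty c := ⟨⟨y, hy⟩⟩
  have hbdd : ∀ x, BddBelow (Set.range fun p : c ↦ p.1.ofDual x) := fun x ↦
    ⟨0, by rintro _ ⟨p, rfl⟩; exact (hc p.1 p.2).nonneg x⟩
  have hle : ∀ (p : c) x, ⨅ p : c, p.1.ofDual x ≤ p.1.ofDual x := fun p x ↦ ciInf_le (hbdd x) p
  have hdir : ∀ p q : c, ∃ r : c, r.1.ofDual ≤ p.1.ofDual ∧ r.1.ofDual ≤ q.1.ofDual := fun p q ↦ by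
    rcases hchain.total p.2 q.2 with h | h
    · exact ⟨q, h, le_rfl⟩
    · exact ⟨p, le_rfl, h⟩
  have h0 : ∀ x, 0 ≤ ⨅ p : c, p.1.ofDual x := fun x ↦ Real.iInf_nonneg fun p ↦ (hc p.1 p.2).nonneg x
  refine ⟨OrderDual.toDual fun x ↦ ⨅ p : c, p.1.ofDual x, ⟨h0, ?_, fun x y ↦ ?_, fun x y ↦ ?_,
    fun a x ↦ ?_⟩, fun p hp x ↦ hle ⟨p, hp⟩ x⟩
  · exact le_ciInf fun p ↦ (hc p.1 p.2).one
  · change (⨅ p : c, p.1.ofDual (x + y)) ≤ (⨅ p : c, p.1.ofDual x) + ⨅ p : c, p.1.ofDual y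
    rw [← sub_le_iff_le_add']
    refine le_ciInf fun p ↦ ?_
    rw [sub_le_comm]
    refine le_ciInf fun q ↦ ?_
    obtain ⟨r, h1, h2⟩ := hdir p q
    have := (hc r.1 r.2).add x y
    have h3 := hle r (x + y)
    have h4 := h1 y
    have h5 := h2 x
    linarith
  · change (⨅ p : c, p.1.ofDual (x * y)) ≤ (⨅ p : c, p.1.ofDual x) * ⨅ p : c, p.1.ofDual y
    rw [Real.iInf_mul_of_nonneg (h0 y)]
    refine le_ciInf fun p ↦ ?_
    rw [Real.mul_iInf_of_nonneg ((hc p.1 p.2).nonneg x)]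
    refine le_ciInf fun q ↦ ?_
    obtain ⟨r, h1, h2⟩ := hdir p q
    exact (hle r _).trans (((hc r.1 r.2).mul x y).trans (mul_le_mul (h1 x) (h2 y)
      ((hc r.1 r.2).nonneg y) ((hc p.1 p.2).nonneg x)))
  · change (⨅ p : c, p.1.ofDual (a • x)) ≤ v a * ⨅ p : c, p.1.ofDual x
    rw [Real.mul_iInf_of_nonneg (v.nonneg a)]
    exact le_ciInf fun p ↦ (hle p _).trans ((hc p.1 p.2).smul a x)

/-- The norm `∑ p(aᵢ) rⁱ` of a polynomial `∑ aᵢ Xⁱ`. -/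
def polyNorm (p : L → ℝ) (r : ℝ) (P : L[X]) : ℝ := P.sum fun i a ↦ p a * r ^ i

section PolyNorm

variable {v : AbsoluteValue K ℝ} {p : L → ℝ} (hp : IsAlgSeminorm v p) {r : ℝ} (hr : 0 < r)
include hp

lemma polyNorm_eq_sum_range {P : L[X]} {n : ℕ} (h : P.natDegree < n) :
    polyNorm p r P = ∑ i ∈ Finset.range n, p (P.coeff i) * r ^ i :=
  P.sum_over_range' (fun i ↦ by simp [hp.zero]) n h

lemma polyNorm_monomial (n : ℕ) (a : L) : polyNorm p r (monomial n a) = p a * r ^ n :=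
  sum_monomial_index _ _ (by simp [hp.zero])

include hr

lemma polyNorm_nonneg (P : L[X]) : 0 ≤ polyNorm p r P :=
  Finset.sum_nonneg fun _ _ ↦ mul_nonneg (hp.nonneg _) (by positivity)

lemma sum_range_le_polyNorm (P : L[X]) (n : ℕ) :
    ∑ i ∈ Finset.range n, p (P.coeff i) * r ^ i ≤ polyNorm p r P := by
  rw [polyNorm_eq_sum_range hp (n := max n (P.natDegree + 1)) (by simp)]
  exact Finset.sum_le_sum_of_subset_of_nonneg (Finset.range_mono (le_max_left _ _))
    fun _ _ _ ↦ mul_nonneg (hp.nonneg _) (by positivity)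

lemma polyNorm_add (P Q : L[X]) : polyNorm p r (P + Q) ≤ polyNorm p r P + polyNorm p r Q := by
  set n := max (P + Q).natDegree (max P.natDegree Q.natDegree) + 1
  rw [polyNorm_eq_sum_range hp (n := n) (by grind), polyNorm_eq_sum_range hp (n := n) (by grind),
    polyNorm_eq_sum_range hp (n := n) (by grind), ← Finset.sum_add_distrib]
  refine Finset.sum_le_sum fun i _ ↦ ?_
  rw [coeff_add, ← add_mul]
  exact mul_le_mul_of_nonneg_right (hp.add _ _) (by positivity)

lemma polyNorm_mul (P Q : L[X]) : polyNorm p r (P * Q) ≤ polyNorm p r P * polyNorm p r Q := by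
  have hsum : ∀ (s : Finset ℕ) (g : ℕ → L[X]),
      polyNorm p r (∑ i ∈ s, g i) ≤ ∑ i ∈ s, polyNorm p r (g i) := fun s g ↦
    Finset.le_sum_of_subadditive _ (by simp [polyNorm]) (polyNorm_add hp hr) s g
  rw [mul_eq_sum_sum]
  refine (hsum _ _).trans ?_
  rw [polyNorm, polyNorm, sum_def, sum_def, Finset.sum_mul_sum]
  refine Finset.sum_le_sum fun i _ ↦ ?_
  rw [sum_def]
  refine (hsum _ _).trans (Finset.sum_le_sum fun j _ ↦ ?_)
  rw [polyNorm_monomial hp, pow_add]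
  have := mul_le_mul_of_nonneg_right (hp.mul (P.coeff i) (Q.coeff j)) (by positivity : 0 ≤ r ^ i * r ^ j)
  linarith

/-- This says that the quotient seminorm on `L[X] / (X - f)` does not collapse. A collapse would
make the expansion of `(f - X)⁻¹` have finite norm at radius `r`, which the lower bounds on the
powers of `f⁻¹` forbid. -/
lemma one_le_polyNorm {f : L} (hf : f ≠ 0) (h : ∀ n : ℕ, 1 ≤ r ^ n * p (f⁻¹ ^ n)) {P : L[X]}
    (hP : P.eval f = 1) : 1 ≤ polyNorm p r P := by
  by_contra! hlt
  obtain ⟨Q, hQ⟩ : (X - C f) ∣ 1 - P := dvd_iff_isRoot.mpr (by simp [hP])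
  -- `F` is the expansion of `1 / (f - X)`. From `1 - P = (X - f) Q` follows `F = P F - Q`, a
  -- contraction estimate for `F` since `P` has norm below 1.
  set F : PowerSeries L := PowerSeries.mk fun i ↦ f⁻¹ ^ (i + 1) with hF
  have hinv : ((X - C f : L[X]) : PowerSeries L) * F = -1 := by
    ext n
    rw [coe_sub, coe_X, coe_C, sub_mul, map_sub, PowerSeries.coeff_C_mul]
    cases n with
    | zero => simp [hF, hf]
    | succ n =>
      rw [PowerSeries.coeff_succ_X_mul]
      simp only [hF, PowerSeries.coeff_mk, map_neg, PowerSeries.coeff_one]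
      rw [pow_succ' f⁻¹ (n + 1), mul_inv_cancel_left₀ hf]
      simp
  have hrec : F = (P : PowerSeries L) * F - (Q : PowerSeries L) := by
    have h1 : (1 - (P : PowerSeries L)) * F = - (Q : PowerSeries L) := by
      rw [← coe_one, ← coe_sub, hQ, coe_mul, mul_right_comm, hinv]; simp
    linear_combination h1
  set w : ℕ → ℝ := fun n ↦ p (f⁻¹ ^ (n + 1)) * r ^ n with hw
  have hw0 : ∀ n, 0 ≤ w n := fun n ↦ mul_nonneg (hp.nonneg _) (by positivity)
  have hstep : ∀ n, w n ≤ p (Q.coeff n) * r ^ n +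
      ∑ k ∈ Finset.range (n + 1), p (P.coeff k) * r ^ k * w (n - k) := fun n ↦ by
    have h1 : f⁻¹ ^ (n + 1) = (∑ k ∈ Finset.range (n + 1), P.coeff k * f⁻¹ ^ (n - k + 1)) +
        -Q.coeff n := by
      have := congr(PowerSeries.coeff n $hrec)
      rw [map_sub, PowerSeries.coeff_mul, Finset.Nat.sum_antidiagonal_eq_sum_range_succ_mk] at this
      simpa [hF, sub_eq_add_neg] using this
    have h2 : p (f⁻¹ ^ (n + 1)) ≤
        (∑ k ∈ Finset.range (n + 1), p (P.coeff k) * p (f⁻¹ ^ (n - k + 1))) + p (Q.coeff n) := by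
      rw [h1]
      exact (hp.add _ _).trans (add_le_add ((hp.sum_le _ _).trans
        (Finset.sum_le_sum fun _ _ ↦ hp.mul _ _)) (hp.neg _))
    calc w n ≤ _ := mul_le_mul_of_nonneg_right h2 (by positivity : 0 ≤ r ^ n)
      _ = _ := by
        rw [add_mul, add_comm, Finset.sum_mul]
        congr 1
        refine Finset.sum_congr rfl fun k hk ↦ ?_
        have hk' : n = k + (n - k) := by have := Finset.mem_range.mp hk; omega
        have hpow : r ^ n = r ^ k * r ^ (n - k) := by rw [← pow_add, ← hk']
        rw [hw, hpow]; ring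
  -- Working with partial sums avoids any convergence question. They are bounded by `‖Q‖ / (1 -
  -- ‖P‖)`, yet grow at least like `n / r` because each term is at least `r⁻¹`.
  have hbound : ∀ n, ∑ i ∈ Finset.range n, w i ≤
      polyNorm p r Q + polyNorm p r P * ∑ i ∈ Finset.range n, w i := fun n ↦ by
    refine (Finset.sum_le_sum fun i _ ↦ hstep i).trans ?_
    rw [Finset.sum_add_distrib]
    refine add_le_add (sum_range_le_polyNorm hp hr Q n) ?_
    rw [Finset.sum_range_diag_flip n fun k m ↦ p (P.coeff k) * r ^ k * w m]
    refine le_trans ?_ (mul_le_mul_of_nonneg_right (sum_range_le_polyNorm hp hr P n)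
      (Finset.sum_nonneg fun i _ ↦ hw0 i))
    rw [Finset.sum_mul]
    refine Finset.sum_le_sum fun m _ ↦ ?_
    rw [← Finset.mul_sum]
    refine mul_le_mul_of_nonneg_left ?_ (mul_nonneg (hp.nonneg _) (by positivity))
    exact Finset.sum_le_sum_of_subset_of_nonneg (Finset.range_mono (by omega)) fun i _ _ ↦ hw0 i
  have hlow : ∀ n : ℕ, n * r⁻¹ ≤ ∑ i ∈ Finset.range n, w i := fun n ↦ by
    have : ∀ i ∈ Finset.range n, r⁻¹ ≤ w i := fun i _ ↦ by
      rw [inv_le_iff_one_le_mul₀ hr]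
      refine (h (i + 1)).trans (le_of_eq ?_)
      rw [hw]; ring
    simpa using Finset.card_nsmul_le_sum _ _ _ this
  obtain ⟨n, hn⟩ := exists_nat_gt (polyNorm p r Q / (1 - polyNorm p r P) * r)
  have h1 := hbound n
  have h2 := hlow n
  have h3 : ∑ i ∈ Finset.range n, w i ≤ polyNorm p r Q / (1 - polyNorm p r P) := by
    rw [le_div_iff₀ (by linarith)]; linarith
  have h4 : polyNorm p r Q / (1 - polyNorm p r P) < n * r⁻¹ := by
    rwa [← div_eq_mul_inv, lt_div_iff₀ hr]
  linarith

end PolyNorm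

/-- The operator seminorm `x ↦ sup_y p (x y) / p y` is again an algebra seminorm below `p`, and its
value at 1 is at most 1. Terms with `p y = 0` count as 0 and are harmless. -/
lemma IsAlgSeminorm.one_eq_of_minimal {v : AbsoluteValue K ℝ} {p : L → ℝ} (hp : IsAlgSeminorm v p)
    (hmin : ∀ q : L → ℝ, IsAlgSeminorm v q → q ≤ p → p ≤ q) : p 1 = 1 := by
  have hbound : ∀ x y, p (x * y) / p y ≤ p x := fun x y ↦
    div_le_of_le_mul₀ (hp.nonneg _) (hp.nonneg _) (hp.mul x y)
  have hle : ∀ x y, p (x * y) / p y ≤ ⨆ y, p (x * y) / p y := fun x y ↦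
    le_ciSup (f := fun y ↦ p (x * y) / p y) ⟨p x, by rintro _ ⟨y, rfl⟩; exact hbound x y⟩ y
  have h0 : ∀ x, 0 ≤ ⨆ y, p (x * y) / p y := fun x ↦
    Real.iSup_nonneg fun y ↦ div_nonneg (hp.nonneg _) (hp.nonneg _)
  have hpos : p 1 ≠ 0 := (zero_lt_one.trans_le hp.one).ne'
  refine hp.one.antisymm' ((hmin (fun x ↦ ⨆ y, p (x * y) / p y) ⟨h0, ?_, fun x y ↦ ?_,
    fun x y ↦ ?_, fun a x ↦ ?_⟩ (fun x ↦ ciSup_le (hbound x)) 1).trans ?_)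
  · simpa [hpos] using hle 1 1
  · refine ciSup_le fun z ↦ le_trans ?_ (add_le_add (hle x z) (hle y z))
    rw [← add_div, add_mul]
    exact div_le_div_of_nonneg_right (hp.add _ _) (hp.nonneg _)
  · refine ciSup_le fun z ↦ le_trans ?_ (mul_le_mul (hle x (y * z)) (hle y z)
      (div_nonneg (hp.nonneg _) (hp.nonneg _)) (h0 x))
    rw [mul_assoc]
    -- If this vanishes, then so does `p (x * (y * z))` by submultiplicativity; otherwise the
    -- quotients telescope.
    by_cases h : p (y * z) = 0
    · have := hp.mul x (y * z)
      rw [h, mul_zero] at this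
      simp [le_antisymm this (hp.nonneg _)]
    · rw [div_mul_div_cancel₀ h]
  · refine ciSup_le fun z ↦ le_trans ?_ (mul_le_mul_of_nonneg_left (hle x z) (v.nonneg a))
    rw [← mul_div_assoc, smul_mul_assoc]
    exact div_le_div_of_nonneg_right (hp.smul _ _) (hp.nonneg _)
  · refine ciSup_le fun z ↦ ?_
    rw [one_mul]
    exact div_self_le_one _

/-- The inequality `|f| ≤ r` is imposed by passing to the quotient seminorm of the weighted
polynomial norm under `X ↦ f`. When it does not collapse, it is an algebra seminorm below `p`, hence
equal to `p` by minimality. -/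
lemma IsAlgSeminorm.le_of_minimal {v : AbsoluteValue K ℝ} {p : L → ℝ} (hp : IsAlgSeminorm v p)
    (hmin : ∀ q : L → ℝ, IsAlgSeminorm v q → q ≤ p → p ≤ q) {f : L} (hf : f ≠ 0) {r : ℝ}
    (hr : 0 < r) (h : ∀ n : ℕ, 1 ≤ r ^ n * p (f⁻¹ ^ n)) : p f ≤ r := by
  let q : L → ℝ := fun g ↦ ⨅ P : {P : L[X] // P.eval f = g}, polyNorm p r P.1
  have hne : ∀ g, Nonempty {P : L[X] // P.eval f = g} := fun g ↦ ⟨⟨C g, by simp⟩⟩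
  have hnn := polyNorm_nonneg hp hr
  have hle : ∀ P : L[X], q (P.eval f) ≤ polyNorm p r P := fun P ↦
    ciInf_le (f := fun P' : {P' : L[X] // P'.eval f = P.eval f} ↦ polyNorm p r P'.1)
      ⟨0, by rintro _ ⟨P, rfl⟩; exact hnn _⟩ ⟨P, rfl⟩
  have hq0 : ∀ g, 0 ≤ q g := fun g ↦ Real.iInf_nonneg fun P ↦ hnn _
  have hq : IsAlgSeminorm v q := by
    refine ⟨hq0, le_ciInf fun P ↦ one_le_polyNorm hp hr hf h P.2, fun x y ↦ ?_, fun x y ↦ ?_,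
      fun a x ↦ ?_⟩
    · rw [← sub_le_iff_le_add']
      refine le_ciInf fun P ↦ ?_
      rw [sub_le_comm]
      refine le_ciInf fun Q ↦ ?_
      have h1 := hle (Q.1 + P.1)
      rw [eval_add, P.2, Q.2] at h1
      linarith [polyNorm_add hp hr Q.1 P.1]
    · change q (x * y) ≤ q x * ⨅ P : {P : L[X] // P.eval f = y}, polyNorm p r P.1
      rw [Real.mul_iInf_of_nonneg (hq0 x)]
      refine le_ciInf fun P ↦ ?_
      change q (x * y) ≤ (⨅ P : {P : L[X] // P.eval f = x}, polyNorm p r P.1) * _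
      rw [Real.iInf_mul_of_nonneg (hnn _)]
      refine le_ciInf fun Q ↦ ?_
      have h1 := hle (Q.1 * P.1)
      rw [eval_mul, P.2, Q.2] at h1
      exact h1.trans (polyNorm_mul hp hr _ _)
    · change q (a • x) ≤ v a * ⨅ P : {P : L[X] // P.eval f = x}, polyNorm p r P.1
      rw [Real.mul_iInf_of_nonneg (v.nonneg a)]
      refine le_ciInf fun P ↦ ?_
      have h1 := hle (a • P.1)
      rw [eval_smul, P.2] at h1
      refine h1.trans ?_
      rw [polyNorm_eq_sum_range hp (P := P.1) (Nat.lt_succ_self _),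
        polyNorm_eq_sum_range hp ((natDegree_smul_le a P.1).trans_lt (Nat.lt_succ_self _)),
        Finset.mul_sum]
      refine Finset.sum_le_sum fun i _ ↦ ?_
      rw [coeff_smul, ← mul_assoc]
      exact mul_le_mul_of_nonneg_right (hp.smul _ _) (by positivity)
  have hqp : q ≤ p := fun g ↦ by
    have := hle (C g)
    rwa [eval_C, ← monomial_zero_left, polyNorm_monomial hp, pow_zero, mul_one] at this
  -- The polynomial `X` represents `f` and has norm `p 1 * r = r`.
  have := hle (monomial 1 1)
  rw [eval_monomial, polyNorm_monomial hp] at this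
  simp only [hp.one_eq_of_minimal hmin, one_mul, pow_one] at this
  exact (hmin q hq hqp f).trans this

/-- For `r < p f` and `s < p f⁻¹`, the contrapositive of `le_of_minimal` yields `r ^ n * p (f⁻¹ ^ n)
< 1` and `s ^ m * p (f ^ m) < 1`. Raising these to the powers `m` and `n` and multiplying
contradicts `1 ≤ p 1` unless `r * s ≤ 1`; then `r` and `s` approach their bounds. -/
lemma IsAlgSeminorm.mul_inv_le_of_minimal {v : AbsoluteValue K ℝ} {p : L → ℝ}
    (hp : IsAlgSeminorm v p) (hmin : ∀ q : L → ℝ, IsAlgSeminorm v q → q ≤ p → p ≤ q) {f : L}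
    (hf : f ≠ 0) : p f * p f⁻¹ ≤ 1 := by
  have hpow : ∀ g : L, g ≠ 0 → ∀ r, 0 < r → r < p g → ∃ n : ℕ, r ^ n * p (g⁻¹ ^ n) < 1 := by
    intro g hg r hr hrg
    by_contra! h
    exact hrg.not_ge (hp.le_of_minimal hmin hg hr h)
  have hpp : ∀ (g : L) (n m : ℕ), n ≠ 0 → p (g ^ (m * n)) ≤ p (g ^ m) ^ n := by
    intro g n m hn
    rw [pow_mul]
    induction n with
    | zero => exact absurd rfl hn
    | succ n ih =>
      rcases eq_or_ne n 0 with rfl | hn'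
      · simp
      · rw [pow_succ, pow_succ]
        exact (hp.mul _ _).trans (mul_le_mul_of_nonneg_right (ih hn') (hp.nonneg _))
  have key : ∀ r s, 0 < r → r < p f → 0 < s → s < p f⁻¹ → r * s ≤ 1 := by
    intro r s hr hrf hs hsf
    obtain ⟨n, hn⟩ := hpow f hf r hr hrf
    obtain ⟨m, hm⟩ := hpow f⁻¹ (inv_ne_zero hf) s hs hsf
    rw [inv_inv] at hm
    -- A zero exponent would give `p 1 < 1`.
    have hn0 : n ≠ 0 := by
      rintro rfl
      simpa using hn.trans_le hp.one
    have hm0 : m ≠ 0 := by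
      rintro rfl
      simpa using hm.trans_le hp.one
    by_contra! h
    have h1 : 1 ≤ (r * s) ^ (n * m) := one_le_pow₀ h.le
    have h2 : 1 ≤ p (f ^ (m * n)) * p (f⁻¹ ^ (n * m)) := by
      rw [mul_comm m n]
      refine hp.one.trans ?_
      have := hp.mul (f ^ (n * m)) (f⁻¹ ^ (n * m))
      rwa [← mul_pow, mul_inv_cancel₀ hf, one_pow] at this
    have h3 : (s ^ m * p (f ^ m)) ^ n < 1 :=
      pow_lt_one₀ (mul_nonneg (by positivity) (hp.nonneg _)) hm hn0
    have h4 : (r ^ n * p (f⁻¹ ^ n)) ^ m < 1 :=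
      pow_lt_one₀ (mul_nonneg (by positivity) (hp.nonneg _)) hn hm0
    have h5 : p (f ^ (m * n)) * p (f⁻¹ ^ (n * m)) ≤ p (f ^ m) ^ n * p (f⁻¹ ^ n) ^ m :=
      mul_le_mul (hpp _ _ _ hn0) (hpp _ _ _ hm0) (hp.nonneg _) (pow_nonneg (hp.nonneg _) _)
    have h6 : (s ^ m * p (f ^ m)) ^ n * (r ^ n * p (f⁻¹ ^ n)) ^ m =
        (r * s) ^ (n * m) * (p (f ^ m) ^ n * p (f⁻¹ ^ n) ^ m) := by
      rw [mul_pow, mul_pow, mul_pow, ← pow_mul, ← pow_mul, mul_comm m n]; ring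
    have h7 := mul_lt_one_of_nonneg_of_lt_one_left (pow_nonneg (mul_nonneg (by positivity)
      (hp.nonneg _)) n) h3 h4.le
    rw [h6] at h7
    nlinarith
  have h1 : ∀ g, g ≠ 0 → 0 < p g := fun g hg ↦ by
    refine (hp.nonneg g).lt_of_ne fun h ↦ ?_
    have := hp.one.trans ((mul_inv_cancel₀ hg ▸ le_rfl : p 1 ≤ p (g * g⁻¹)).trans (hp.mul g g⁻¹))
    rw [← h, zero_mul] at this
    linarith
  by_contra! h
  obtain ⟨r, hr1, hr2⟩ : ∃ r, (p f⁻¹)⁻¹ < r ∧ r < p f :=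
    exists_between (by rwa [inv_lt_iff_one_lt_mul₀ (h1 _ (inv_ne_zero hf))])
  have hr : 0 < r := (inv_pos.mpr (h1 _ (inv_ne_zero hf))).trans hr1
  obtain ⟨s, hs1, hs2⟩ : ∃ s, r⁻¹ < s ∧ s < p f⁻¹ :=
    exists_between (inv_lt_of_inv_lt₀ (h1 _ (inv_ne_zero hf)) hr1)
  have := key r s hr hr2 ((inv_pos.mpr hr).trans hs1) hs2
  rw [inv_lt_iff_one_lt_mul₀ hr] at hs1
  linarith

variable (L) in
/-- An absolute value on a field extends to every finite field extension. -/
theorem exists_absoluteValue_extension [FiniteDimensional K L] (v : AbsoluteValue K ℝ) :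
    ∃ w : AbsoluteValue L ℝ, ∀ a : K, w (algebraMap K L a) = v a := by
  obtain ⟨p, hp, hmin⟩ := exists_minimal_isAlgSeminorm (L := L) v
  have h1 : p 1 = 1 := hp.one_eq_of_minimal hmin
  have hinv : ∀ f, f ≠ 0 → p f * p f⁻¹ = 1 := fun f hf ↦
    (hp.mul_inv_le_of_minimal hmin hf).antisymm (by
      have := hp.mul f f⁻¹
      rwa [mul_inv_cancel₀ hf, h1] at this)
  have hmul : ∀ x y, p (x * y) = p x * p y := fun x y ↦ by
    rcases eq_or_ne y 0 with rfl | hy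
    · simp [hp.zero]
    refine (hp.mul x y).antisymm ?_
    have h2 := hp.mul (x * y) y⁻¹
    rw [mul_inv_cancel_right₀ hy] at h2
    calc p x * p y ≤ p (x * y) * p y⁻¹ * p y := mul_le_mul_of_nonneg_right h2 (hp.nonneg _)
      _ = p (x * y) := by rw [mul_assoc, mul_comm (p y⁻¹), hinv y hy, mul_one]
  have hle : ∀ a : K, p (algebraMap K L a) ≤ v a := fun a ↦ by
    simpa [Algebra.algebraMap_eq_smul_one, h1] using hp.smul a 1
  refine ⟨⟨⟨p, hmul⟩, hp.nonneg, fun x ↦ ⟨fun h ↦ ?_, fun h ↦ h ▸ hp.zero⟩, hp.add⟩, fun a ↦ ?_⟩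
  · by_contra hx
    have := hinv x hx
    rw [show p x = 0 from h, zero_mul] at this
    exact zero_ne_one this
  -- The inequality `p ≤ v` on `K`, applied to `a⁻¹`, gives the reverse inequality for `a`, since
  -- `p` is now multiplicative on inverses.
  · refine (hle a).antisymm ?_
    rcases eq_or_ne a 0 with rfl | ha
    · simpa using hp.nonneg _
    have h2 := hinv (algebraMap K L a) (by simpa using ha)
    have h3 := hle a⁻¹
    rw [map_inv₀, map_inv₀] at h3
    have h4 : 0 < v a := v.pos ha
    calc v a = v a * (p (algebraMap K L a) * p (algebraMap K L a)⁻¹) := by rw [h2, mul_one]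
      _ ≤ v a * (p (algebraMap K L a) * (v a)⁻¹) := by
          gcongr
          exact hp.nonneg _
      _ = p (algebraMap K L a) := by field_simp

end AbsExt

/-! ### Multiplicative seminorms as absolute values on fields -/

section SeminormToField

/-- An absolute value on a domain extends to the fraction field. -/
lemma exists_absoluteValue_fractionRing {D L : Type*} [CommRing D] [IsDomain D] [Field L]
    [Algebra D L] [IsFractionRing D L] (w : AbsoluteValue D ℝ) :
    ∃ W : AbsoluteValue L ℝ, ∀ x, W (algebraMap D L x) = w x := by
  have hsurj : ∀ z : L, ∃ a b : D, b ≠ 0 ∧ algebraMap D L a / algebraMap D L b = z := fun z ↦ by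
    obtain ⟨a, b, hb, h⟩ := IsFractionRing.div_surjective (A := D) z
    exact ⟨a, b, nonZeroDivisors.ne_zero hb, h⟩
  choose n d hd hnd using hsurj
  have hd' : ∀ z, algebraMap D L (d z) ≠ 0 := fun z ↦ by simpa using hd z
  have hwd : ∀ z, w (d z) ≠ 0 := fun z ↦ w.ne_zero (hd z)
  have hwd' : ∀ z, 0 < w (d z) := fun z ↦ w.pos (hd z)
  -- The value does not depend on the fraction chosen to represent `z`, so each axiom may be checked
  -- on a convenient fraction.
  have key : ∀ (z : L) (a b : D), b ≠ 0 → algebraMap D L a / algebraMap D L b = z →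
      w (n z) / w (d z) = w a / w b := fun z a b hb h ↦ by
    rw [← hnd z, div_eq_div_iff (by simpa using hb) (hd' z)] at h
    rw [div_eq_div_iff (hwd z) (w.ne_zero hb), ← map_mul, ← map_mul]
    congr 1
    apply IsFractionRing.injective D L
    simpa using h.symm
  refine ⟨⟨⟨fun z ↦ w (n z) / w (d z), fun x y ↦ ?_⟩, fun z ↦ by positivity, fun z ↦ ?_,
    fun x y ↦ ?_⟩, fun x ↦ ?_⟩
  · rw [key (x * y) (n x * n y) (d x * d y) (mul_ne_zero (hd x) (hd y)), map_mul, map_mul,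
      div_mul_div_comm]
    rw [map_mul, map_mul, ← div_mul_div_comm, hnd, hnd]
  · change w (n z) / w (d z) = 0 ↔ z = 0
    rw [div_eq_zero_iff, or_iff_left (hwd z), w.eq_zero]
    conv_rhs => rw [← hnd z, div_eq_zero_iff, or_iff_left (hd' z)]
    simp
  · change w (n (x + y)) / w (d (x + y)) ≤ w (n x) / w (d x) + w (n y) / w (d y)
    rw [key (x + y) (n x * d y + d x * n y) (d x * d y) (mul_ne_zero (hd x) (hd y)),
      div_add_div _ _ (hwd x) (hwd y), map_mul]
    · refine div_le_div_of_nonneg_right ?_ (by positivity)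
      simpa using w.add_le (n x * d y) (d x * n y)
    · rw [map_add, map_mul, map_mul, map_mul, ← div_add_div _ _ (hd' x) (hd' y), hnd, hnd]
  · change w (n _) / w (d _) = _
    rw [key _ x 1 one_ne_zero (by simp), map_one, div_one]

/-- Every multiplicative seminorm is the pullback of an absolute value on a field. -/
lemma exists_field_of_mulRingSeminorm {R : Type u} [CommRing R] (c : MulRingSeminorm R) :
    ∃ (L : Type u) (_ : Field L) (g : R →+* L) (W : AbsoluteValue L ℝ), ∀ x, W (g x) = c x := by
  let I : Ideal R :=
    { carrier := {x | c x = 0}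
      add_mem' := fun {x y} hx hy ↦ le_antisymm
        ((map_add_le_add c x y).trans (by rw [show c x = 0 from hx, show c y = 0 from hy]; simp))
        (apply_nonneg c _)
      zero_mem' := map_zero c
      smul_mem' := fun a x hx ↦ by
        rw [Set.mem_ofPred_eq, smul_eq_mul, map_mul, show c x = 0 from hx, mul_zero] }
  have hI : ∀ x, x ∈ I ↔ c x = 0 := fun x ↦ Iff.rfl
  have : I.IsPrime := by
    refine ⟨fun h ↦ ?_, fun {x y} h ↦ ?_⟩
    · have : c 1 = 0 := (hI 1).mp (h ▸ Submodule.mem_top)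
      simp at this
    · rw [hI, map_mul, mul_eq_zero] at h
      exact h
  have hcongr : ∀ x y, x - y ∈ I → c x = c y := fun x y h ↦ by
    have := abs_sub_map_le_sub c x y
    rw [(hI _).mp h] at this
    exact sub_eq_zero.mp (abs_nonpos_iff.mp this)
  let w₀ : R ⧸ I → ℝ := Quotient.lift c fun x y h ↦
    hcongr x y ((Submodule.quotientRel_def I).mp h)
  have hw₀ : ∀ x, w₀ (Ideal.Quotient.mk I x) = c x := fun x ↦ rfl
  let w : AbsoluteValue (R ⧸ I) ℝ := by
    refine ⟨⟨w₀, fun x y ↦ ?_⟩, fun x ↦ ?_, fun x ↦ ?_, fun x y ↦ ?_⟩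
    · obtain ⟨x, rfl⟩ := Ideal.Quotient.mk_surjective x
      obtain ⟨y, rfl⟩ := Ideal.Quotient.mk_surjective y
      rw [← map_mul, hw₀, hw₀, hw₀, map_mul]
    · obtain ⟨x, rfl⟩ := Ideal.Quotient.mk_surjective x
      exact apply_nonneg c x
    · obtain ⟨x, rfl⟩ := Ideal.Quotient.mk_surjective x
      exact (Ideal.Quotient.eq_zero_iff_mem.trans (hI x)).symm
    · obtain ⟨x, rfl⟩ := Ideal.Quotient.mk_surjective x
      obtain ⟨y, rfl⟩ := Ideal.Quotient.mk_surjective y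
      exact map_add_le_add c x y
  obtain ⟨W, hW⟩ := exists_absoluteValue_fractionRing (L := FractionRing (R ⧸ I)) w
  exact ⟨FractionRing (R ⧸ I), inferInstance,
    (algebraMap (R ⧸ I) (FractionRing (R ⧸ I))).comp (Ideal.Quotient.mk I), W, fun x ↦ hW _⟩

end SeminormToField

/-! ### Points of the analytification -/

section Points

variable {A : Type u} [NormedCommRing A] {X : Scheme.{u}} (π : X ⟶ Spec (CommRingCat.of A))

/-- The ring homomorphism `A → Γ(X, U)`, for an open subset `U` of an `A`-scheme. -/
def toSections (U : X.Opens) : A →+* Γ(X, U) :=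
  ((Scheme.ΓSpecIso (CommRingCat.of A)).inv ≫ π.appTop ≫ X.presheaf.map (homOfLE le_top).op).hom

variable {π}

lemma evaluation_map {U V : X.Opens} (h : V ≤ U) (p : X) (hp : p ∈ V) (f : Γ(X, U)) :
    X.evaluation V p hp (X.presheaf.map (homOfLE h).op f) = X.evaluation U p (h hp) f := by
  simp only [Scheme.evaluation, CommRingCat.comp_apply]
  rw [TopCat.Presheaf.germ_res_apply]

lemma evaluation_toSections (U : X.Opens) (p : X) (hp : p ∈ U) (a : A) :
    X.evaluation U p hp (toSections π U a) = toResidueField π p a :=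
  evaluation_map le_top p hp _

/-- The kernel of `g` is a prime of `Γ(X, U)`, that is, a point of `U`. The map `g` factors through
the local ring and then the residue field there, and `W` pulls back to an absolute value on it. All
points constructed below arise in this way. -/
lemma An.exists_absVal_eq {U : X.Opens} (hU : IsAffineOpen U) {L : Type*} [Field L]
    (g : Γ(X, U) →+* L) (W : AbsoluteValue L ℝ) (h : ∀ a : A, W (g (toSections π U a)) ≤ ‖a‖) :
    ∃ (y : An π) (hy : y.pt ∈ U), ∀ f, y.absVal hy f = W (g f) := by
  obtain ⟨P, hP⟩ : ∃ P : PrimeSpectrum Γ(X, U), ∀ f, f ∈ P.asIdeal ↔ g f = 0 :=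
    ⟨⟨RingHom.ker g, RingHom.ker_isPrime g⟩, fun f ↦ Iff.rfl⟩
  let p : X := hU.fromSpec P
  have hp : p ∈ U := by
    have : p ∈ Set.range hU.fromSpec := ⟨P, rfl⟩
    rwa [hU.range_fromSpec] at this
  let : Algebra Γ(X, U) (X.presheaf.stalk p) := (X.presheaf.germ U p hp).hom.toAlgebra
  have hloc : IsLocalization.AtPrime (X.presheaf.stalk p) P.asIdeal :=
    hU.isLocalization_stalk' P hp
  have hunit : ∀ y : P.asIdeal.primeCompl, IsUnit (g y) := fun y ↦ Ne.isUnit fun h ↦ y.2 ((hP _).mpr h)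
  let g₁ : X.presheaf.stalk p →+* L := IsLocalization.lift hunit
  have hg₁ : ∀ f, g₁ (X.presheaf.germ U p hp f) = g f := fun f ↦ IsLocalization.lift_eq hunit f
  have : IsLocalHom g₁ := by
    refine ⟨fun x hx ↦ ?_⟩
    obtain ⟨a, b, rfl⟩ := IsLocalization.exists_mk'_eq P.asIdeal.primeCompl x
    rw [IsLocalization.AtPrime.isUnit_mk'_iff (X.presheaf.stalk p) P.asIdeal]
    intro ha
    rw [IsLocalization.lift_mk', (hP a).mp ha, zero_mul] at hx
    exact not_isUnit_zero hx
  let g₂ : X.residueField p →+* L := IsLocalRing.ResidueField.lift g₁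
  have hg₂ : ∀ f, g₂ (X.evaluation U p hp f) = g f := fun f ↦ hg₁ f
  refine ⟨⟨p, W.comp (f := g₂) g₂.injective, fun a ↦ ?_⟩, hp, fun f ↦ ?_⟩
  · change W (g₂ (toResidueField π p a)) ≤ _
    rw [← evaluation_toSections U p hp, hg₂]
    exact h a
  · change W (g₂ (X.evaluation U p hp f)) = _
    rw [hg₂]

end Points

/-! ### Fibres of the analytification over Zariski dense points -/

section Fibre

/-- An absolute value on a domain extends to a field-valued point of any flat algebra of finite
type. -/
lemma exists_field_point_of_flat {A R : Type u} [CommRing A] [IsDomain A] [CommRing R]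
    [Nontrivial R] (f : A →+* R) (hft : f.FiniteType) (hfl : f.Flat) (x : AbsoluteValue A ℝ) :
    ∃ (L : Type u) (_ : Field L) (g : R →+* L) (W : AbsoluteValue L ℝ), ∀ a, W (g (f a)) = x a := by
  algebraize [f]
  obtain ⟨v, hv⟩ := exists_absoluteValue_fractionRing (L := FractionRing A) x
  -- Flatness keeps `A → Frac A` injective after tensoring with `R`, so the generic fibre is not
  -- empty.
  have hinj : Function.Injective (Algebra.TensorProduct.includeRight : R →ₐ[A] FractionRing A ⊗[A] R) :=
    Algebra.TensorProduct.includeRight_injective (IsFractionRing.injective A (FractionRing A))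
  have : Nontrivial (FractionRing A ⊗[A] R) := hinj.nontrivial
  obtain ⟨m, hm⟩ := Ideal.exists_maximal (FractionRing A ⊗[A] R)
  let := Ideal.Quotient.field m
  -- Zariski's lemma: the residue field of a closed point of the generic fibre is finite over `Frac
  -- A`.
  have : Module.Finite (FractionRing A) ((FractionRing A ⊗[A] R) ⧸ m) :=
    finite_of_finite_type_of_isJacobsonRing _ _
  obtain ⟨W, hW⟩ := exists_absoluteValue_extension ((FractionRing A ⊗[A] R) ⧸ m) v
  refine ⟨_, inferInstance, (Ideal.Quotient.mk m).comp
    (Algebra.TensorProduct.includeRight : R →ₐ[A] FractionRing A ⊗[A] R).toRingHom, W, fun a ↦ ?_⟩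
  rw [← hv, ← hW]
  congr 1
  exact congr(Ideal.Quotient.mk m $((Algebra.TensorProduct.includeRight :
    R →ₐ[A] FractionRing A ⊗[A] R).commutes a))

variable {A : Type u} [NormedCommRing A] {X : Scheme.{u}}
  {π : X ⟶ Spec (CommRingCat.of A)}

lemma toSections_eq (U : X.Opens) :
    toSections π U = (π.appLE ⊤ U le_top).hom.comp
      (Scheme.ΓSpecIso (CommRingCat.of A)).commRingCatIsoToRingEquiv.symm.toRingHom := by
  rfl

/-- Any nonempty affine open subset is flat and of finite type over `A`, so it already contains a
suitable point. Zariski density makes the seminorm `x` an absolute value on `A`, which is what can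
be extended to the fraction field. -/
lemma IsVariety.exists_structureMap_eq [IsDomain A] (hvar : IsVariety π) (x : BerkovichSpectrum A)
    (hx : x.IsZariskiDense) : ∃ y : An π, y.structureMap = x := by
  have := hvar.isIntegral
  have := hvar.locallyOfFiniteType
  have := hvar.flat
  obtain ⟨p⟩ : Nonempty X := inferInstance
  obtain ⟨U, hU, hp, -⟩ := exists_isAffineOpen_mem_and_subset (U := ⊤) (x := p) trivial
  have : Nonempty U := ⟨⟨p, hp⟩⟩
  have hft : (toSections π U).FiniteType := by
    rw [toSections_eq]
    exact (π.finiteType_appLE (isAffineOpen_top _) hU _).comp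
      (RingHom.FiniteType.of_surjective _ (RingEquiv.surjective _))
  have hfl : (toSections π U).Flat := by
    rw [toSections_eq]
    exact RingHom.Flat.comp (.of_bijective (RingEquiv.bijective _))
      (π.flat_appLE (isAffineOpen_top _) hU _)
  obtain ⟨L, _, g, W, hW⟩ := exists_field_point_of_flat (toSections π U) hft hfl
    ⟨⟨x.1, map_mul x.1⟩, apply_nonneg x.1, fun a ↦ ⟨hx a, fun h ↦ h ▸ map_zero x.1⟩,
      map_add_le_add x.1⟩
  have hW' : ∀ a, W (g (toSections π U a)) = x.1 a := hW
  obtain ⟨y, hy, h⟩ := An.exists_absVal_eq (π := π) hU g W fun a ↦ (hW' a).trans_le (x.2 a)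
  refine ⟨y, Subtype.ext (MulRingSeminorm.ext fun a ↦ ?_)⟩
  rw [← hW' a, ← h, An.absVal, evaluation_toSections]
  rfl

end Fibre

/-! ### Compactness from charts -/

section Charts

open Filter Topology

variable {A : Type u} [NormedCommRing A] {X : Scheme.{u}} {π : X ⟶ Spec (CommRingCat.of A)}

namespace An

variable {U V : X.Opens} (y : An π) (hy : y.pt ∈ U)

lemma absVal_nonneg (f : Γ(X, U)) : 0 ≤ y.absVal hy f := y.val.nonneg _

lemma absVal_mul (f g : Γ(X, U)) : y.absVal hy (f * g) = y.absVal hy f * y.absVal hy g := by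
  simp [absVal]

lemma absVal_pow (f : Γ(X, U)) (n : ℕ) : y.absVal hy (f ^ n) = y.absVal hy f ^ n := by
  simp [absVal]

lemma absVal_add_le (f g : Γ(X, U)) : y.absVal hy (f + g) ≤ y.absVal hy f + y.absVal hy g := by
  simpa [absVal] using y.val.add_le _ _

lemma absVal_neg (f : Γ(X, U)) : y.absVal hy (-f) = y.absVal hy f := by
  simp [absVal]

lemma absVal_zero : y.absVal hy (0 : Γ(X, U)) = 0 := by
  simp [absVal]

lemma absVal_one : y.absVal hy (1 : Γ(X, U)) = 1 := by
  simp [absVal]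

lemma absVal_map (h : V ≤ U) (hy : y.pt ∈ V) (f : Γ(X, U)) :
    y.absVal hy (X.presheaf.map (homOfLE h).op f) = y.absVal (h hy) f := by
  rw [absVal, evaluation_map]; rfl

lemma absVal_toSections_le (a : A) : y.absVal hy (toSections π U a) ≤ ‖a‖ := by
  rw [absVal, evaluation_toSections]
  exact y.bounded a

lemma absVal_ne_zero_iff (f : Γ(X, U)) : y.absVal hy f ≠ 0 ↔ y.pt ∈ X.basicOpen f := by
  rw [absVal, ne_eq, y.val.eq_zero, ← ne_eq, Scheme.evaluation_ne_zero_iff_mem_basicOpen]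

/-- The function `y ↦ |f(y)|`, extended by zero outside `U^an`. -/
def extAbsVal (f : Γ(X, U)) (y : An π) : ℝ :=
  open scoped Classical in if hy : y.pt ∈ U then y.absVal hy f else 0

lemma extAbsVal_eq (f : Γ(X, U)) : extAbsVal f y = y.absVal hy f := dif_pos hy

/-- Convergence of functions on an affine open subset implies convergence in the
analytification. -/
lemma le_nhds_of_tendsto (hU : IsAffineOpen U) (F : Filter (An π))
    (hF : ∀ᶠ z in F, z.pt ∈ U)
    (h : ∀ f : Γ(X, U), Tendsto (extAbsVal f) F (𝓝 (y.absVal hy f))) : F ≤ 𝓝 y := by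
  rw [← tendsto_id', TopologicalSpace.tendsto_nhds_generateFrom_iff]
  rintro _ ⟨V, g, W, hW, rfl⟩ ⟨hyV, hgW⟩
  -- The subbasic condition involves a function `g` on an arbitrary open `V`. On a basic open subset
  -- of `U` inside `V` it becomes `a / f ^ n` with `a` and `f` regular on `U`, where convergence is
  -- known.
  obtain ⟨f, hfV, hyf⟩ := hU.exists_basicOpen_le ⟨y.pt, hyV⟩ hy
  have hfU := X.basicOpen_le f
  have := hU.isLocalization_basicOpen f
  obtain ⟨⟨a, ⟨_, n, rfl⟩⟩, ha⟩ := IsLocalization.surj (Submonoid.powers f)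
    (X.presheaf.map (homOfLE hfV).op g)
  have key : ∀ z : An π, ∀ hz : z.pt ∈ X.basicOpen f,
      z.absVal (hfV hz) g = extAbsVal a z / extAbsVal f z ^ n := fun z hz ↦ by
    have h0 := (z.absVal_ne_zero_iff (hfU hz) f).mpr hz
    rw [extAbsVal_eq z (hfU hz), extAbsVal_eq z (hfU hz), eq_div_iff (pow_ne_zero _ h0)]
    have := congr(z.absVal hz $ha)
    rw [absVal_mul, absVal_map] at this
    rw [← absVal_pow, ← absVal_map z hfU hz, ← absVal_map z hfU hz]
    exact this
  have h0 := (y.absVal_ne_zero_iff hy f).mpr hyf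
  have hlim : Tendsto (fun z ↦ extAbsVal a z / extAbsVal f z ^ n) F
      (𝓝 (y.absVal hyV g)) := by
    have := (h a).div ((h f).pow n) (pow_ne_zero _ h0)
    rwa [← extAbsVal_eq y hy, ← extAbsVal_eq y hy, ← key y hyf] at this
  filter_upwards [hF, (h f).eventually_ne h0, hlim.eventually_mem (hW.mem_nhds hgW)] with z hzU hz hzW
  have hzf : z.pt ∈ X.basicOpen f := by
    rwa [extAbsVal_eq z hzU, absVal_ne_zero_iff] at hz
  exact ⟨hfV hzf, by rw [← key z hzf] at hzW; exact hzW⟩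

end An

/-- An analytification covered by finitely many unit polydiscs is compact. -/
lemma compactSpace_of_charts {ι κ : Type*} [Finite ι] (U : ι → X.Opens)
    (hU : ∀ j, IsAffineOpen (U j)) (t : ∀ j, κ → Γ(X, U j))
    (hgen : ∀ j, Subring.closure (Set.range (toSections π (U j)) ∪ Set.range (t j)) = ⊤)
    (hcov : ∀ y : An π, ∃ j, ∃ hy : y.pt ∈ U j, ∀ k, y.absVal hy (t j k) ≤ 1) :
    CompactSpace (An π) := by
  refine ⟨isCompact_iff_ultrafilter_le_nhds.mpr fun F _ ↦ ?_⟩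
  let K : ι → Set (An π) := fun j ↦ {y | ∃ hy : y.pt ∈ U j, ∀ k, y.absVal hy (t j k) ≤ 1}
  -- An ultrafilter contains one member of any finite cover.
  obtain ⟨j, hj⟩ : ∃ j, K j ∈ F := by
    by_contra! h
    obtain ⟨y, hy⟩ := (Filter.eventually_all.mpr fun j ↦
      Ultrafilter.eventually_not.mpr (h j)).exists
    obtain ⟨j, hj⟩ := hcov y
    exact hy j hj
  -- On the polydisc the generators are bounded, by `‖a‖` for constants and by 1 for coordinates, so
  -- every function generated by them is bounded.
  have hb : ∀ f : Γ(X, U j), ∃ C, ∀ y ∈ K j, An.extAbsVal f y ∈ Set.Icc 0 C := fun f ↦ by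
    suffices h : ∃ C, ∀ y : An π, ∀ hy : y.pt ∈ U j, (∀ k, y.absVal hy (t j k) ≤ 1) →
        y.absVal hy f ≤ C by
      obtain ⟨C, hC⟩ := h
      refine ⟨C, fun y ⟨hy, h⟩ ↦ ?_⟩
      rw [An.extAbsVal_eq y hy]
      exact ⟨y.absVal_nonneg hy f, hC y hy h⟩
    have hf : f ∈ Subring.closure (Set.range (toSections π (U j)) ∪ Set.range (t j)) :=
      hgen j ▸ trivial
    induction hf using Subring.closure_induction with
    | mem f hf =>
      rcases hf with ⟨a, rfl⟩ | ⟨k, rfl⟩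
      · exact ⟨‖a‖, fun y hy _ ↦ y.absVal_toSections_le hy a⟩
      · exact ⟨1, fun y hy h ↦ h k⟩
    | zero => exact ⟨0, fun y hy _ ↦ (y.absVal_zero hy).le⟩
    | one => exact ⟨1, fun y hy _ ↦ (y.absVal_one hy).le⟩
    | add f g _ _ hf hg =>
      obtain ⟨C, hC⟩ := hf
      obtain ⟨D, hD⟩ := hg
      exact ⟨C + D, fun y hy h ↦ (y.absVal_add_le hy f g).trans (add_le_add (hC y hy h) (hD y hy h))⟩
    | neg f _ hf =>
      obtain ⟨C, hC⟩ := hf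
      exact ⟨C, fun y hy h ↦ (y.absVal_neg hy f).trans_le (hC y hy h)⟩
    | mul f g _ _ hf hg =>
      obtain ⟨C, hC⟩ := hf
      obtain ⟨D, hD⟩ := hg
      refine ⟨C * D, fun y hy h ↦ (y.absVal_mul hy f g).trans_le
        (mul_le_mul (hC y hy h) (hD y hy h) (y.absVal_nonneg hy g)
          ((y.absVal_nonneg hy f).trans (hC y hy h)))⟩
  -- Bounded values converge along an ultrafilter. The limits form a multiplicative seminorm,
  -- bounded by the norm on `A`, and the corresponding point of `U j` is the limit of the
  -- ultrafilter.
  have hlim : ∀ f : Γ(X, U j), ∃ c, Tendsto (An.extAbsVal (π := π) f) F (𝓝 c) := fun f ↦ by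
    obtain ⟨C, hC⟩ := hb f
    obtain ⟨c, -, hc⟩ := isCompact_Icc.ultrafilter_le_nhds (F.map (An.extAbsVal f))
      (le_principal_iff.mpr (mem_map.mpr (Filter.mem_of_superset hj hC)))
    exact ⟨c, hc⟩
  choose c hc using hlim
  have hmem : ∀ᶠ y in (F : Filter (An π)), y.pt ∈ U j := by
    filter_upwards [hj] with y hy using hy.1
  let s : MulRingSeminorm Γ(X, U j) :=
    { toFun := c
      map_zero' := tendsto_nhds_unique (hc 0) <| tendsto_const_nhds.congr' <| by
        filter_upwards [hmem] with y hy
        rw [An.extAbsVal_eq y hy, y.absVal_zero]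
      add_le' := fun f g ↦ le_of_tendsto_of_tendsto (hc _) ((hc f).add (hc g)) <| by
        filter_upwards [hmem] with y hy
        rw [An.extAbsVal_eq y hy, An.extAbsVal_eq y hy, An.extAbsVal_eq y hy]
        exact y.absVal_add_le hy f g
      neg' := fun f ↦ tendsto_nhds_unique (hc _) <| (hc f).congr' <| by
        filter_upwards [hmem] with y hy
        rw [An.extAbsVal_eq y hy, An.extAbsVal_eq y hy, y.absVal_neg]
      map_one' := tendsto_nhds_unique (hc 1) <| tendsto_const_nhds.congr' <| by
        filter_upwards [hmem] with y hy
        rw [An.extAbsVal_eq y hy, y.absVal_one]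
      map_mul' := fun f g ↦ tendsto_nhds_unique (hc _) <| ((hc f).mul (hc g)).congr' <| by
        filter_upwards [hmem] with y hy
        rw [An.extAbsVal_eq y hy, An.extAbsVal_eq y hy, An.extAbsVal_eq y hy, y.absVal_mul] }
  have hs : ∀ f, s f = c f := fun f ↦ rfl
  obtain ⟨L, _, g, W, hW⟩ := exists_field_of_mulRingSeminorm s
  obtain ⟨y, hy, h⟩ := An.exists_absVal_eq (π := π) (hU j) g W fun a ↦ by
    rw [hW, hs]
    refine le_of_tendsto (hc _) ?_
    filter_upwards [hmem] with y hy
    rw [An.extAbsVal_eq y hy]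
    exact y.absVal_toSections_le hy a
  exact ⟨y, trivial, y.le_nhds_of_tendsto hy (hU j) F hmem fun f ↦ by
    rw [h, hW, hs]
    exact hc f⟩

end Charts

/-! ### Coordinates on `Proj` -/

section ProjCoordinates

open HomogeneousLocalization

variable {σ : Type*} {S : Type u} [CommRing S] [SetLike σ S] [AddSubgroupClass σ S] (𝒜 : ℕ → σ)
  [GradedRing 𝒜]

/-- The coordinate `g / f` on `D₊(f)`, for `f` and `g` of degree one. -/
def ratio {f g : S} (hf : f ∈ 𝒜 1) (hg : g ∈ 𝒜 1) : Γ(Proj 𝒜, Proj.basicOpen 𝒜 f) :=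
  Proj.awayToSection 𝒜 f (Away.mk 𝒜 hf 1 g (by simpa using hg))

variable {𝒜}

lemma stalkIso_germ_awayToSection (f : S) (x : Proj 𝒜) (hx : x ∈ Proj.basicOpen 𝒜 f)
    (z : Away 𝒜 f) :
    (Proj.stalkIso 𝒜 x).hom ((Proj 𝒜).presheaf.germ _ x hx (Proj.awayToSection 𝒜 f z)) =
      HomogeneousLocalization.mapId 𝒜 (Submonoid.powers_le.mpr hx) z :=
  Proj.stalkIso'_germ 𝒜 (Proj.basicOpen 𝒜 f) x hx (Proj.awayToSection 𝒜 f z)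

lemma mem_basicOpen_of_evaluation_ratio_ne_zero {f g : S} (hf : f ∈ 𝒜 1) (hg : g ∈ 𝒜 1)
    (x : Proj 𝒜) (hx : x ∈ Proj.basicOpen 𝒜 f)
    (h : (Proj 𝒜).evaluation _ x hx (ratio 𝒜 hf hg) ≠ 0) : x ∈ Proj.basicOpen 𝒜 g := by
  rw [Scheme.evaluation_ne_zero_iff_mem_basicOpen, Scheme.mem_basicOpen _ _ _ hx] at h
  have h1 := h.map (Proj.stalkIso 𝒜 x).hom.hom
  have h2 := stalkIso_germ_awayToSection f x hx (Away.mk 𝒜 hf 1 g (by simpa using hg))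
  have h3 := (h2 ▸ h1 : IsUnit (HomogeneousLocalization.mapId 𝒜 (Submonoid.powers_le.mpr hx)
    (Away.mk 𝒜 hf 1 g _)))
  rw [← isUnit_iff_isUnit_val] at h3
  have : x.asHomogeneousIdeal.toIdeal.IsPrime := x.isPrime
  have h4 : (HomogeneousLocalization.mapId 𝒜 (Submonoid.powers_le.mpr hx)
    (Away.mk 𝒜 hf 1 g (by simpa using hg))).val = Localization.mk g
      (⟨f ^ 1, by simpa using hx⟩ : x.asHomogeneousIdeal.toIdeal.primeCompl) := rfl
  rw [h4, Localization.mk_eq_mk', IsLocalization.AtPrime.isUnit_mk'_iff] at h3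
  exact h3

lemma evaluation_ratio_mul {f g h : S} (hf : f ∈ 𝒜 1) (hg : g ∈ 𝒜 1) (hh : h ∈ 𝒜 1)
    (x : Proj 𝒜) (hxf : x ∈ Proj.basicOpen 𝒜 f) (hxg : x ∈ Proj.basicOpen 𝒜 g) :
    (Proj 𝒜).evaluation _ x hxg (ratio 𝒜 hg hh) * (Proj 𝒜).evaluation _ x hxf (ratio 𝒜 hf hg) =
      (Proj 𝒜).evaluation _ x hxf (ratio 𝒜 hf hh) := by
  simp only [Scheme.evaluation, CommRingCat.comp_apply]
  rw [← map_mul]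
  congr 1
  apply (Proj.stalkIso 𝒜 x).commRingCatIsoToRingEquiv.injective
  rw [map_mul]
  change (Proj.stalkIso 𝒜 x).hom _ * (Proj.stalkIso 𝒜 x).hom _ = (Proj.stalkIso 𝒜 x).hom _
  rw [ratio, ratio, ratio, stalkIso_germ_awayToSection, stalkIso_germ_awayToSection,
    stalkIso_germ_awayToSection]
  apply HomogeneousLocalization.val_injective
  rw [HomogeneousLocalization.val_mul]
  have : x.asHomogeneousIdeal.toIdeal.IsPrime := x.isPrime
  have h4 : ∀ (a b : S) (ha : a ∈ 𝒜 1) (hb : b ∈ 𝒜 1) (hxa : x ∈ Proj.basicOpen 𝒜 a),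
      (HomogeneousLocalization.mapId 𝒜 (Submonoid.powers_le.mpr hxa)
    (Away.mk 𝒜 ha 1 b (by simpa using hb))).val = Localization.mk b
      (⟨a ^ 1, by simpa using hxa⟩ : x.asHomogeneousIdeal.toIdeal.primeCompl) :=
    fun _ _ _ _ _ ↦ rfl
  rw [h4 _ _ hg hh hxg, h4 _ _ hf hg hxf, h4 _ _ hf hh hxf, Localization.mk_mul,
    Localization.mk_eq_mk_iff, Localization.r_iff_exists]
  exact ⟨1, by simp; ring⟩

lemma ι_comp_toSpecZero (f : S) {m : ℕ} (hf : f ∈ 𝒜 m) (hm : 0 < m) :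
    (Proj.basicOpen 𝒜 f).ι ≫ Proj.toSpecZero 𝒜 = Proj.basicOpenToSpec 𝒜 f ≫
      Spec.map (CommRingCat.ofHom (fromZeroRingHom 𝒜 _)) := by
  rw [← Proj.awayι_toSpecZero 𝒜 f hf hm, Proj.awayι, ← Proj.basicOpenIsoSpec_hom 𝒜 f hf hm]
  simp

/-- The structure map of projective space passes through the spectrum of the degree-zero part. This
formula locates the constants in each chart, as the generation statement `closure_coord` requires.
-/
lemma toSpecZero_appTop_map (f : S) {m : ℕ} (hf : f ∈ 𝒜 m) (hm : 0 < m) :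
    (Scheme.ΓSpecIso (.of (𝒜 0))).inv ≫ (Proj.toSpecZero 𝒜).appTop ≫
      (Proj 𝒜).presheaf.map (homOfLE (le_top : Proj.basicOpen 𝒜 f ≤ ⊤)).op =
      CommRingCat.ofHom (fromZeroRingHom 𝒜 _) ≫ Proj.awayToSection 𝒜 f := by
  have h := congr(Scheme.Hom.appTop $(ι_comp_toSpecZero f hf hm))
  rw [Scheme.Hom.comp_appTop, Scheme.Hom.comp_appTop] at h
  have h1 : (Proj.basicOpenToSpec 𝒜 f).appTop = _ := Proj.basicOpenToSpec_app_top 𝒜 f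
  rw [h1] at h
  have h2 : (Proj 𝒜).presheaf.map (homOfLE (le_top : Proj.basicOpen 𝒜 f ≤ ⊤)).op =
      (Proj.basicOpen 𝒜 f).ι.appTop ≫ (Proj.basicOpen 𝒜 f).topIso.hom := by
    exact (Proj 𝒜).presheaf.map_comp _ _
  rw [h2, reassoc_of% h, ← Scheme.ΓSpecIso_inv_naturality_assoc]
  simp only [Iso.inv_hom_id_assoc, Iso.inv_hom_id, Category.comp_id]

lemma ratio_self {f : S} (hf : f ∈ 𝒜 1) : ratio 𝒜 hf hf = 1 := by
  rw [ratio, ← map_one (Proj.awayToSection 𝒜 f).hom]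
  congr 1
  apply HomogeneousLocalization.val_injective
  rw [Away.val_mk, HomogeneousLocalization.val_one, ← Localization.mk_one, Localization.mk_eq_mk_iff,
    Localization.r_iff_exists]
  exact ⟨1, by simp⟩

lemma awayMk_prod_pow {f : S} (hf : f ∈ 𝒜 1) {ι : Type*} [Fintype ι] (v : ι → S)
    (hv : ∀ i, v i ∈ 𝒜 1) (a : ℕ) (b : ι → ℕ) (hab : ∑ i, b i = a) (h) :
    Away.mk 𝒜 hf a (∏ i, v i ^ b i) h =
      ∏ i, Away.mk 𝒜 hf 1 (v i) (by simpa using hv i) ^ b i := by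
  apply HomogeneousLocalization.val_injective
  have h1 : ∀ z : Away 𝒜 f, z.val = algebraMap (Away 𝒜 f) (Localization (Submonoid.powers f)) z :=
    fun _ ↦ rfl
  rw [h1, h1, map_prod]
  simp_rw [map_pow, ← h1, Away.val_mk, Localization.mk_pow]
  rw [Localization.mk_prod]
  congr 1
  ext
  simp [← hab, Finset.prod_pow_eq_pow_sum]

end ProjCoordinates

/-! ### Compactness of projective analytifications -/

section Projective

variable {A : Type u} [NormedCommRing A]

open HomogeneousLocalization

local instance (n : ℕ) : GradedAlgebra (MvPolynomial.homogeneousSubmodule (Fin (n + 1)) A) :=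
  MvPolynomial.gradedAlgebra

variable (A) in
abbrev polyGrading (n : ℕ) := MvPolynomial.homogeneousSubmodule (Fin (n + 1)) A

lemma X_mem_polyGrading {n : ℕ} (j : Fin (n + 1)) : (MvPolynomial.X j : MvPolynomial _ A) ∈ polyGrading A n 1 :=
  MvPolynomial.isHomogeneous_X A j

lemma adjoin_range_X (n : ℕ) : Algebra.adjoin (polyGrading A n 0)
    (Set.range (MvPolynomial.X : Fin (n + 1) → MvPolynomial (Fin (n + 1)) A)) = ⊤ := by
  have h := MvPolynomial.adjoin_range_X (R := A) (σ := Fin (n + 1))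
  refine top_le_iff.mp fun p _ ↦ ?_
  induction (h ▸ trivial : p ∈ Algebra.adjoin A (Set.range (MvPolynomial.X (R := A) (σ := Fin (n + 1))))) using Algebra.adjoin_induction with
  | mem x hx => exact Algebra.subset_adjoin hx
  | algebraMap a =>
    exact Subalgebra.algebraMap_mem (Algebra.adjoin (polyGrading A n 0) _) (algebraMap A _ a)
  | add x y _ _ hx hy => exact add_mem (hx trivial) (hy trivial)
  | mul x y _ _ hx hy => exact mul_mem (hx trivial) (hy trivial)

/-- The standard affine open subset `T_j ≠ 0` of projective space. -/
def stdOpen {n : ℕ} (j : Fin (n + 1)) : (ProjSpace A n).Opens :=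
  Proj.basicOpen (polyGrading A n) (MvPolynomial.X j)

/-- The coordinate `T_k / T_j` on the standard affine open subset `T_j ≠ 0`. -/
def coord {n : ℕ} (j k : Fin (n + 1)) : Γ(ProjSpace A n, stdOpen j) :=
  ratio (polyGrading A n) (X_mem_polyGrading j) (X_mem_polyGrading k)

lemma isAffineOpen_stdOpen {n : ℕ} (j : Fin (n + 1)) : IsAffineOpen (stdOpen (A := A) j) :=
  Proj.isAffineOpen_basicOpen (polyGrading A n) _ (X_mem_polyGrading j) one_pos

lemma coord_self {n : ℕ} (j : Fin (n + 1)) : coord (A := A) j j = 1 := ratio_self _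

lemma mem_stdOpen_of_evaluation_coord_ne_zero {n : ℕ} (j k : Fin (n + 1)) (x : ProjSpace A n)
    (hx : x ∈ stdOpen j) (h : (ProjSpace A n).evaluation _ x hx (coord j k) ≠ 0) :
    x ∈ stdOpen k :=
  mem_basicOpen_of_evaluation_ratio_ne_zero _ _ x hx h

lemma evaluation_coord_mul {n : ℕ} (i j k : Fin (n + 1)) (x : ProjSpace A n) (hi : x ∈ stdOpen i)
    (hj : x ∈ stdOpen j) :
    (ProjSpace A n).evaluation _ x hj (coord j k) * (ProjSpace A n).evaluation _ x hi (coord i j) =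
      (ProjSpace A n).evaluation _ x hi (coord i k) :=
  evaluation_ratio_mul _ _ _ x hi hj

lemma toSections_projSpace {n : ℕ} (j : Fin (n + 1)) (a : A) :
    toSections (ProjSpace.toSpec A n) (stdOpen j) a =
      Proj.awayToSection (polyGrading A n) (MvPolynomial.X j)
        (fromZeroRingHom _ _ (algebraMap A (polyGrading A n 0) a)) := by
  have h := congr($(toSpecZero_appTop_map (𝒜 := polyGrading A n) (MvPolynomial.X j)
    (X_mem_polyGrading j) one_pos) (algebraMap A (polyGrading A n 0) a))
  refine Eq.trans ?_ h
  have h1 := Scheme.ΓSpecIso_inv_naturality (CommRingCat.ofHom (algebraMap A (polyGrading A n 0)))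
  have h2 := congr($h1 a)
  exact congr(((Proj (polyGrading A n)).presheaf.map _).hom
    ((Proj.toSpecZero (polyGrading A n)).appTop.hom $h2)).symm

/-- The degree-zero localization is spanned over the degree-zero part by monomials in the ratios
`T_k / T_j`, and the degree-zero part consists of constants from `A`. -/
lemma closure_coord {n : ℕ} (j : Fin (n + 1)) :
    Subring.closure (Set.range (toSections (ProjSpace.toSpec A n) (stdOpen j)) ∪
      Set.range (coord j)) = ⊤ := by
  set T := Subring.closure (Set.range (toSections (ProjSpace.toSpec A n) (stdOpen j)) ∪
      Set.range (coord j))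
  have hsurj : ∀ f : Γ(ProjSpace A n, stdOpen j), ∃ z, Proj.awayToSection (polyGrading A n) (MvPolynomial.X j) z = f :=
    (Proj.basicOpenIsoAway (polyGrading A n) (MvPolynomial.X j) (X_mem_polyGrading j)
      one_pos).commRingCatIsoToRingEquiv.surjective
  refine top_le_iff.mp fun f _ ↦ ?_
  obtain ⟨z, rfl⟩ := hsurj f
  have hz : z ∈ Submodule.span _ _ := (Away.span_mk_prod_pow_eq_top (X_mem_polyGrading j)
    (MvPolynomial.X (R := A)) (adjoin_range_X n) (fun _ ↦ 1) X_mem_polyGrading).symm ▸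
      Submodule.mem_top
  induction hz using Submodule.span_induction with
  | mem x hx =>
    obtain ⟨a, b, hab, rfl⟩ := hx
    rw [awayMk_prod_pow (X_mem_polyGrading j) _ X_mem_polyGrading a b (by simpa using hab)]
    change (Proj.awayToSection (polyGrading A n) (MvPolynomial.X j)).hom _ ∈ T
    rw [map_prod]
    refine prod_mem (S := T) fun k _ ↦ ?_
    rw [map_pow]
    have hk : coord j k ∈ T := Subring.subset_closure (Set.mem_union_right _ ⟨k, rfl⟩)
    exact pow_mem hk _
  | zero =>
    change (Proj.awayToSection (polyGrading A n) (MvPolynomial.X j)).hom _ ∈ T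
    rw [map_zero]
    exact zero_mem T
  | add x y _ _ hx hy =>
    change (Proj.awayToSection (polyGrading A n) (MvPolynomial.X j)).hom _ ∈ T
    rw [map_add]
    exact add_mem (hx trivial) (hy trivial)
  | smul a x _ hx =>
    change (Proj.awayToSection (polyGrading A n) (MvPolynomial.X j)).hom _ ∈ T
    rw [Algebra.smul_def, map_mul]
    refine mul_mem ?_ (hx trivial)
    obtain ⟨a, rfl⟩ : ∃ a', algebraMap A (polyGrading A n 0) a' = a := by
      obtain ⟨a, ha⟩ := a
      rw [MvPolynomial.mem_homogeneousSubmodule, ← MvPolynomial.totalDegree_zero_iff_isHomogeneous,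
        MvPolynomial.totalDegree_eq_zero_iff_eq_C] at ha
      exact ⟨a.coeff 0, Subtype.ext ha.symm⟩
    exact Subring.subset_closure (Set.mem_union_left _ ⟨a, toSections_projSpace j a⟩)

lemma iSup_stdOpen (n : ℕ) : ⨆ j : Fin (n + 1), stdOpen (A := A) j = ⊤ :=
  Proj.iSup_basicOpen_eq_top' _ _ (fun j ↦ ⟨1, X_mem_polyGrading j⟩) (adjoin_range_X n)

/-- In any chart containing the point, take the homogeneous coordinate of largest absolute value and
divide by it. It is nonzero because the chart's own coordinate has value 1. -/
lemma exists_absVal_coord_le_one {n : ℕ} (y : An (ProjSpace.toSpec A n)) :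
    ∃ (j : Fin (n + 1)) (hy : y.pt ∈ stdOpen j), ∀ k, y.absVal hy (coord j k) ≤ 1 := by
  obtain ⟨i, hi⟩ := Opens.mem_iSup.mp ((iSup_stdOpen (A := A) n).ge (Set.mem_univ y.pt))
  obtain ⟨j, hj⟩ := Finite.exists_max fun k ↦ y.absVal hi (coord i k)
  have hpos : 0 < y.absVal hi (coord i j) := by
    refine zero_lt_one.trans_le (le_trans (le_of_eq ?_) (hj i))
    rw [coord_self, y.absVal_one hi]
  have hyj := mem_stdOpen_of_evaluation_coord_ne_zero i j y.pt hi fun h ↦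
    hpos.ne' ((congrArg y.val h).trans (map_zero _))
  refine ⟨j, hyj, fun k ↦ ?_⟩
  have h : y.absVal hyj (coord j k) * y.absVal hi (coord i j) = y.absVal hi (coord i k) :=
    (map_mul y.val _ _).symm.trans congr(y.val $(evaluation_coord_mul i j k y.pt hi hyj))
  refine le_of_mul_le_mul_right (a := y.absVal hi (coord i j)) ?_ hpos
  rw [one_mul]
  exact h.trans_le (hj k)

section

variable {X Y : Scheme.{u}} {π : X ⟶ Spec (CommRingCat.of A)} {ρ : Y ⟶ Spec (CommRingCat.of A)}

lemma An.absVal_map_app (g : X ⟶ Y) (hg : g ≫ ρ = π) (y : An π) {V : Y.Opens} (hy : g y.pt ∈ V)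
    (f : Γ(Y, V)) : (y.map g hg).absVal (U := V) hy f = y.absVal (U := g ⁻¹ᵁ V) hy (g.app V f) := by
  exact congr(y.val $(Scheme.evaluation_naturality_apply g y.pt hy f))

lemma app_toSections (g : X ⟶ Y) (hg : g ≫ ρ = π) (V : Y.Opens) (a : A) :
    g.app V (toSections ρ V a) = toSections π (g ⁻¹ᵁ V) a := by
  subst hg
  exact congr($(g.naturality (homOfLE (le_top : V ≤ ⊤)).op)
    (ρ.appTop.hom ((Scheme.ΓSpecIso (CommRingCat.of A)).inv.hom a)))

end

/-- The analytification of a projective scheme over `A` is compact. -/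
theorem IsProjective.compactSpace {X : Scheme.{u}} {π : X ⟶ Spec (CommRingCat.of A)}
    (h : IsProjective π) : CompactSpace (An π) := by
  obtain ⟨n, i, hi, hπ⟩ := h
  refine compactSpace_of_charts (fun j ↦ i ⁻¹ᵁ stdOpen j)
    (fun j ↦ (isAffineOpen_stdOpen j).preimage i) (fun j k ↦ i.app (stdOpen j) (coord j k))
    (fun j ↦ ?_) fun y ↦ ?_
  -- A closed immersion is surjective on sections over affine opens, so the generators of each
  -- standard chart restrict to generators.
  · have h := congr(Subring.map (i.app (stdOpen j)).hom $(closure_coord (A := A) j))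
    rw [RingHom.map_closure, ← RingHom.range_eq_map,
      RingHom.range_eq_top.mpr (i.app_surjective _ (isAffineOpen_stdOpen j)), Set.image_union,
      ← Set.range_comp, ← Set.range_comp] at h
    rw [← h]
    congr 3
    ext a
    exact (app_toSections i hπ (stdOpen j) a).symm
  · obtain ⟨j, hj, h⟩ := exists_absVal_coord_le_one (y.map i hπ)
    exact ⟨j, hj, fun k ↦ (An.absVal_map_app i hπ y hj _).symm.trans_le (h k)⟩

end Projective

/-! ### Frames of tensor powers -/

section Frames

variable {X : Scheme.{u}}

/-- Restriction of sections of a sheaf of modules. -/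
abbrev res (M : X.Modules) {U V : X.Opens} (h : V ≤ U) (s : Γ(M, U)) : Γ(M, V) :=
  M.presheaf.map (homOfLE h).op s

/-- Restriction of regular functions. -/
abbrev fres {U V : X.Opens} (h : V ≤ U) (f : Γ(X, U)) : Γ(X, V) :=
  X.presheaf.map (homOfLE h).op f

lemma res_res (M : X.Modules) {U V W : X.Opens} (h : V ≤ U) (h' : W ≤ V) (s : Γ(M, U)) :
    res M h' (res M h s) = res M (h'.trans h) s := by
  simp only [res, ← ConcreteCategory.comp_apply, ← Functor.map_comp]
  rfl

lemma res_smul (M : X.Modules) {U V : X.Opens} (h : V ≤ U) (f : Γ(X, U)) (s : Γ(M, U)) :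
    res M h (f • s) = fres h f • res M h s :=
  Scheme.Modules.map_smul M (homOfLE h) f s

/-- The sheaf of abelian groups underlying a sheaf of modules. -/
def abSheaf (M : X.Modules) : TopCat.Sheaf Ab X := ⟨M.presheaf, M.isSheaf⟩

lemma eq_of_locally_res_eq (M : X.Modules) {U : X.Opens} (s t : Γ(M, U))
    (h : ∀ p ∈ U, ∃ (V : X.Opens) (hV : V ≤ U), p ∈ V ∧ res M hV s = res M hV t) : s = t := by
  choose V hV hp hst using h
  refine TopCat.Sheaf.eq_of_locally_eq' (abSheaf M) (fun p : U ↦ V p.1 p.2) U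
    (fun p ↦ homOfLE (hV p.1 p.2)) (fun p hpU ↦ Opens.mem_iSup.mpr ⟨⟨p, hpU⟩, hp p hpU⟩) s t
    fun p ↦ hst p.1 p.2

lemma eq_of_locally_fres_eq {U : X.Opens} (s t : Γ(X, U))
    (h : ∀ p ∈ U, ∃ (V : X.Opens) (hV : V ≤ U), p ∈ V ∧ fres hV s = fres hV t) : s = t := by
  choose V hV hp hst using h
  refine X.sheaf.eq_of_locally_eq' (fun p : U ↦ V p.1 p.2) U
    (fun p ↦ homOfLE (hV p.1 p.2)) (fun p hpU ↦ Opens.mem_iSup.mpr ⟨⟨p, hpU⟩, hp p hpU⟩) s t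
    fun p ↦ hst p.1 p.2

lemma exists_gluing (M : X.Modules) {ι : Type u} {U : X.Opens} (V : ι → X.Opens)
    (hV : ∀ i, V i ≤ U) (hcov : U ≤ iSup V) (s : ∀ i, Γ(M, V i))
    (h : ∀ i j, res M (inf_le_left : V i ⊓ V j ≤ V i) (s i) = res M inf_le_right (s j)) :
    ∃ t : Γ(M, U), ∀ i, res M (hV i) t = s i :=
  (TopCat.Sheaf.existsUnique_gluing' (abSheaf M) V U (fun i ↦ homOfLE (hV i))
    hcov s h).exists

lemma exists_fgluing {ι : Type u} {U : X.Opens} (V : ι → X.Opens)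
    (hV : ∀ i, V i ≤ U) (hcov : U ≤ iSup V) (s : ∀ i, Γ(X, V i))
    (h : ∀ i j, fres (inf_le_left : V i ⊓ V j ≤ V i) (s i) = fres inf_le_right (s j)) :
    ∃ t : Γ(X, U), ∀ i, fres (hV i) t = s i :=
  (X.sheaf.existsUnique_gluing' V U (fun i ↦ homOfLE (hV i)) hcov s h).exists

variable {L : X.Modules} {U V : X.Opens}

lemma IsFrame.res {e : Γ(L, U)} (he : IsFrame L e) (h : V ≤ U) : IsFrame L (res L h e) :=
  fun W hW ↦ by
    change Function.Bijective fun f : Γ(X, W) ↦ f • BerkovichPSH.res L hW (BerkovichPSH.res L h e)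
    rw [res_res]
    exact he W (hW.trans h)

lemma IsFrame.exists_smul {e : Γ(L, U)} (he : IsFrame L e) (h : V ≤ U) (t : Γ(L, V)) :
    ∃ f : Γ(X, V), f • BerkovichPSH.res L h e = t :=
  (he V h).2 t

lemma IsFrame.smul_injective {e : Γ(L, U)} (he : IsFrame L e) (h : V ≤ U) {f g : Γ(X, V)}
    (hfg : f • BerkovichPSH.res L h e = g • BerkovichPSH.res L h e) : f = g :=
  (he V h).1 hfg

/-- Injectivity over all smaller opens makes local coefficients unique, so they agree on overlaps
and glue. This reduces surjectivity to a local statement, which sheafification can provide. -/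
lemma isFrame_of_locally {e : Γ(L, U)}
    (hinj : ∀ (V : X.Opens) (h : V ≤ U) (f g : Γ(X, V)), f • res L h e = g • res L h e → f = g)
    (hsurj : ∀ (V : X.Opens) (h : V ≤ U) (t : Γ(L, V)), ∀ p ∈ V, ∃ (W : X.Opens) (hW : W ≤ V),
      p ∈ W ∧ ∃ f : Γ(X, W), f • res L (hW.trans h) e = res L hW t) : IsFrame L e := by
  refine fun V h ↦ ⟨fun f g hfg ↦ hinj V h f g hfg, fun t ↦ ?_⟩
  choose W hW hp f hf using hsurj V h t
  obtain ⟨g, hg⟩ := exists_fgluing (U := V) (fun p : V ↦ W p.1 p.2) (fun p ↦ hW p.1 p.2)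
    (fun p hpV ↦ Opens.mem_iSup.mpr ⟨⟨p, hpV⟩, hp p hpV⟩) (fun p ↦ f p.1 p.2) fun p q ↦ by
      refine hinj _ (inf_le_left.trans ((hW p.1 p.2).trans h)) _ _ ?_
      have h1 := congr(res L (inf_le_left : W p.1 p.2 ⊓ W q.1 q.2 ≤ _) $(hf p.1 p.2))
      have h2 := congr(res L (inf_le_right : W p.1 p.2 ⊓ W q.1 q.2 ≤ _) $(hf q.1 q.2))
      rw [res_smul, res_res, res_res] at h1 h2
      exact h1.trans h2.symm
  refine ⟨g, eq_of_locally_res_eq L _ _ fun p hpV ↦ ⟨W p hpV, hW p hpV, hp p hpV, ?_⟩⟩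
  dsimp only
  rw [res_smul, ← hf p hpV, ← hg ⟨p, hpV⟩, res_res]

variable (P : PresheafOfModules.{u} (X.presheaf ⋙ forget₂ CommRingCat RingCat))

/-- Restriction of sections of a presheaf of modules. -/
abbrev pres {U V : X.Opens} (h : V ≤ U) (s : P.obj (op U)) : P.obj (op V) :=
  P.presheaf.map (homOfLE h).op s

lemma pres_presheafPowSection (h : V ≤ U) (s : P.obj (op U)) (n : ℕ) :
    pres (presheafPow P n) h (presheafPowSection P s n) =
      presheafPowSection P (pres P h s) n := by
  induction n with
  | zero => exact map_one (X.presheaf.map (homOfLE h).op).hom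
  | succ n ih =>
    exact (PresheafOfModules.Monoidal.tensorObj_map_tmul (homOfLE h).op
      (presheafPowSection P s n) s).trans (congrArg (· ⊗ₜ[Γ(X, V)] pres P h s) ih)

lemma pres_smul (h : V ≤ U) (f : Γ(X, U)) (s : P.obj (op U)) :
    pres P h (f • s) = fres h f • pres P h s :=
  P.map_smul (homOfLE h).op f s

lemma presheafPowSection_smul (f : Γ(X, U)) (s : P.obj (op U)) (n : ℕ) :
    presheafPowSection P (f • s) n = f ^ n • presheafPowSection P s n := by
  induction n with
  | zero =>
    exact (by simp : (1 : Γ(X, U)) = (f : Γ(X, U)) ^ 0 * (1 : Γ(X, U)))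
  | succ n ih =>
    rw [pow_succ f n]
    exact (congrArg (· ⊗ₜ[Γ(X, U)] (f • s)) ih).trans
      (TensorProduct.smul_tmul_smul (R := Γ(X, U)) (f ^ n) f (presheafPowSection P s n) s)

lemma bijective_smul_tmul {R M N : Type*} [CommRing R] [AddCommGroup M] [AddCommGroup N] [Module R M]
    [Module R N] {m : M} {n : N} (hm : Function.Bijective fun r : R ↦ r • m)
    (hn : Function.Bijective fun r : R ↦ r • n) :
    Function.Bijective fun r : R ↦ r • (m ⊗ₜ[R] n) := by
  let e₁ : R ≃ₗ[R] M := LinearEquiv.ofBijective (LinearMap.toSpanSingleton R M m) hm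
  let e₂ : R ≃ₗ[R] N := LinearEquiv.ofBijective (LinearMap.toSpanSingleton R N n) hn
  convert ((TensorProduct.lid R R).symm.trans (TensorProduct.congr e₁ e₂)).bijective using 2 with r
  change _ = (1 : R) • m ⊗ₜ[R] (r • n)
  rw [one_smul, TensorProduct.tmul_smul]

lemma bijective_smul_presheafPowSection {s : P.obj (op U)}
    (hs : Function.Bijective fun f : Γ(X, U) ↦ f • s) (n : ℕ) :
    Function.Bijective fun f : Γ(X, U) ↦ f • presheafPowSection P s n := by
  induction n with
  | zero =>
    convert! Function.bijective_id (α := Γ(X, U)) using 1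
    funext f
    exact mul_one (f : Γ(X, U))
  | succ n ih => exact bijective_smul_tmul ih hs

variable (L) (n : ℕ)

/-- The canonical map from the presheaf tensor power to the tensor power. -/
def toTensorPow (U : X.Opens) (q : (presheafPow L.val n).obj (op U)) : Γ(tensorPow L n, U) :=
  (((PresheafOfModules.sheafificationAdjunction (𝟙 X.ringCatSheaf.obj)).unit.app
    (presheafPow L.val n)).app (op U)).hom q

lemma toTensorPow_smul (f : Γ(X, U)) (q : (presheafPow L.val n).obj (op U)) :
    toTensorPow L n U (f • q) = f • toTensorPow L n U q :=
  (((PresheafOfModules.sheafificationAdjunction (𝟙 X.ringCatSheaf.obj)).unit.app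
    (presheafPow L.val n)).app (op U)).hom.map_smul f q

lemma res_toTensorPow (h : V ≤ U) (q : (presheafPow L.val n).obj (op U)) :
    res (tensorPow L n) h (toTensorPow L n U q) =
      toTensorPow L n V (pres (presheafPow L.val n) h q) :=
  congr($((CategoryTheory.toSheafify (Opens.grothendieckTopology X)
    (presheafPow L.val n).presheaf).naturality (homOfLE h).op) q).symm

lemma exists_toTensorPow_eq (t : Γ(tensorPow L n, U)) (p : X) (hp : p ∈ U) :
    ∃ (V : X.Opens) (h : V ≤ U), p ∈ V ∧ ∃ q, toTensorPow L n V q = res (tensorPow L n) h t := by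
  have := Presheaf.imageSieve_mem (Opens.grothendieckTopology X)
    (CategoryTheory.toSheafify (Opens.grothendieckTopology X) (presheafPow L.val n).presheaf)
    (U := op U) t
  obtain ⟨V, i, ⟨q, hq⟩, hpV⟩ := this p hp
  exact ⟨V, i.le, hpV, q, hq⟩

lemma exists_pres_eq_of_toTensorPow_eq {q q' : (presheafPow L.val n).obj (op U)}
    (h : toTensorPow L n U q = toTensorPow L n U q') (p : X) (hp : p ∈ U) :
    ∃ (V : X.Opens) (h : V ≤ U), p ∈ V ∧
      pres (presheafPow L.val n) h q = pres (presheafPow L.val n) h q' := by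
  have := Presheaf.equalizerSieve_mem (Opens.grothendieckTopology X)
    (CategoryTheory.toSheafify (Opens.grothendieckTopology X) (presheafPow L.val n).presheaf)
    (X := op U) q q' h
  obtain ⟨V, i, hq, hpV⟩ := this p hp
  exact ⟨V, i.le, hpV, hq⟩

variable {L}

lemma tensorPowSection_eq (s : Γ(L, U)) :
    tensorPowSection L s n = toTensorPow L n U (presheafPowSection L.val s n) := rfl

lemma res_tensorPowSection (h : V ≤ U) (s : Γ(L, U)) :
    res (tensorPow L n) h (tensorPowSection L s n) = tensorPowSection L (res L h s) n := by
  rw [tensorPowSection_eq, res_toTensorPow]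
  exact congrArg (toTensorPow L n V) (pres_presheafPowSection L.val h s n)

lemma tensorPowSection_smul (f : Γ(X, U)) (s : Γ(L, U)) :
    tensorPowSection L (f • s) n = f ^ n • tensorPowSection L s n := by
  rw [tensorPowSection_eq, tensorPowSection_eq, ← toTensorPow_smul]
  exact congrArg (toTensorPow L n U) (presheafPowSection_smul L.val f s n)

/-- The tensor power of a local frame is a local frame. -/
theorem IsFrame.tensorPowSection {e : Γ(L, U)} (he : IsFrame L e) :
    IsFrame (tensorPow L n) (tensorPowSection L e n) := by
  -- The presheaf power already has a frame over `U`. Sheafification is locally injective and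
  -- locally surjective, and so preserves it.
  have hbij : ∀ (V : X.Opens) (h : V ≤ U), Function.Bijective fun f : Γ(X, V) ↦
      f • presheafPowSection L.val (BerkovichPSH.res L h e) n := fun V h ↦
    bijective_smul_presheafPowSection L.val (he V h) n
  refine isFrame_of_locally (fun V h f g hfg ↦ ?_) fun V h t p hp ↦ ?_
  · rw [res_tensorPowSection, tensorPowSection_eq, ← toTensorPow_smul, ← toTensorPow_smul] at hfg
    refine eq_of_locally_fres_eq _ _ fun p hp ↦ ?_
    obtain ⟨W, hW, hpW, h1⟩ := exists_pres_eq_of_toTensorPow_eq L n hfg p hp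
    refine ⟨W, hW, hpW, (hbij W (hW.trans h)).1 ?_⟩
    rw [pres_smul, pres_smul] at h1
    rw [← res_res L h hW]
    have h2 := pres_presheafPowSection L.val hW (BerkovichPSH.res L h e) n
    exact ((congrArg (fres hW f • ·) h2).symm.trans h1).trans (congrArg (fres hW g • ·) h2)
  · obtain ⟨W, hW, hpW, q, hq⟩ := exists_toTensorPow_eq L n t p hp
    obtain ⟨f, rfl⟩ := (hbij W (hW.trans h)).2 q
    refine ⟨W, hW, hpW, f, ?_⟩
    rw [← hq, toTensorPow_smul, res_tensorPowSection]
    rfl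

end Frames

/-! ### Fibres of line bundles -/

section Fibers

lemma bijective_smul_one_tmul {R S M : Type*} [CommRing R] [CommRing S] [Algebra R S]
    [AddCommGroup M] [Module R M] {m : M} (hm : Function.Bijective fun r : R ↦ r • m) :
    Function.Bijective fun a : S ↦ a • ((1 : S) ⊗ₜ[R] m) := by
  let e : R ≃ₗ[R] M := LinearEquiv.ofBijective (LinearMap.toSpanSingleton R M m) hm
  have he : e 1 = m := one_smul R m
  convert! ((TensorProduct.rid R S).symm.trans (TensorProduct.congr (.refl R S) e)).bijective using 1
  funext a
  simp [TensorProduct.smul_tmul', he]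

variable {X : Scheme.{u}} {L : X.Modules} {U V : X.Opens} (p : X) (hp : p ∈ U)

lemma germ_smul (f : Γ(X, U)) (s : Γ(L, U)) :
    TopCat.Presheaf.germ L.presheaf U p hp (f • s) =
      (X.presheaf.germ U p hp f • TopCat.Presheaf.germ L.presheaf U p hp s :
        (↑(TopCat.Presheaf.stalk L.presheaf p) : Type u)) :=
  PresheafOfModules.germ_smul (R := X.presheaf) L.val p U hp f s

lemma germ_res (h : V ≤ U) (hp : p ∈ V) (s : Γ(L, U)) :
    TopCat.Presheaf.germ L.presheaf V p hp (res L h s) =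
      TopCat.Presheaf.germ L.presheaf U p (h hp) s :=
  TopCat.Presheaf.germ_res_apply L.presheaf (homOfLE h) p hp s

lemma germ_fres (h : V ≤ U) (hp : p ∈ V) (f : Γ(X, U)) :
    X.presheaf.germ V p hp (fres h f) = X.presheaf.germ U p (h hp) f :=
  TopCat.Presheaf.germ_res_apply X.presheaf (homOfLE h) p hp f

lemma exists_germ_eq_of_mem (hp : p ∈ U) (r : X.presheaf.stalk p) :
    ∃ (V : X.Opens) (_ : V ≤ U) (hpV : p ∈ V) (f : Γ(X, V)), X.presheaf.germ V p hpV f = r := by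
  obtain ⟨V, hV, f, rfl⟩ := X.presheaf.exists_germ_eq r
  exact ⟨V ⊓ U, inf_le_right, ⟨hV, hp⟩, fres inf_le_left f, germ_fres p inf_le_left ⟨hV, hp⟩ f⟩

lemma IsFrame.bijective_smul_germ {e : Γ(L, U)} (he : IsFrame L e) :
    Function.Bijective fun r : X.presheaf.stalk p ↦
      (r • TopCat.Presheaf.germ L.presheaf U p hp e :
        (↑(TopCat.Presheaf.stalk L.presheaf p) : Type u)) := by
  have key : ∀ (V : X.Opens) (h : V ≤ U) (hpV : p ∈ V) (f : Γ(X, V)),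
      (X.presheaf.germ V p hpV f • TopCat.Presheaf.germ L.presheaf U p hp e :
        (↑(TopCat.Presheaf.stalk L.presheaf p) : Type u)) =
      TopCat.Presheaf.germ L.presheaf V p hpV (f • BerkovichPSH.res L h e) := fun V h hpV f ↦ by
    rw [germ_smul, germ_res]
  refine ⟨fun r r' h ↦ ?_, fun t ↦ ?_⟩
  · obtain ⟨V, hV, hpV, f, rfl⟩ := exists_germ_eq_of_mem p hp r
    obtain ⟨W, hW, hpW, g, rfl⟩ := exists_germ_eq_of_mem p hp r'
    replace h := (key V hV hpV f).symm.trans (h.trans (key W hW hpW g))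
    obtain ⟨Z, hpZ, i, j, hij⟩ := TopCat.Presheaf.germ_eq L.presheaf p hpV hpW _ _ h
    replace hij : BerkovichPSH.res L i.le (f • BerkovichPSH.res L hV e) =
      BerkovichPSH.res L j.le (g • BerkovichPSH.res L hW e) := hij
    rw [res_smul, res_smul, res_res, res_res] at hij
    have := he.smul_injective (i.le.trans hV) hij
    rw [← germ_fres p i.le hpZ, ← germ_fres p j.le hpZ, this]
  · obtain ⟨V, hV, s, rfl⟩ := TopCat.Presheaf.exists_germ_eq L.presheaf t
    obtain ⟨f, hf⟩ := he.exists_smul (V := V ⊓ U) inf_le_right (BerkovichPSH.res L inf_le_left s)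
    refine ⟨X.presheaf.germ (V ⊓ U) p ⟨hV, hp⟩ f, ?_⟩
    exact (key _ inf_le_right ⟨hV, hp⟩ f).trans ((congrArg _ hf).trans
      (germ_res p inf_le_left ⟨hV, hp⟩ s))

lemma evalFiber_res (h : V ≤ U) (hp : p ∈ V) (s : Γ(L, U)) :
    evalFiber L (res L h s) p hp = evalFiber L s p (h hp) := by
  rw [evalFiber, evalFiber, res, TopCat.Presheaf.germ_res_apply]

lemma evalFiber_smul (f : Γ(X, U)) (s : Γ(L, U)) :
    evalFiber L (f • s) p hp = X.evaluation U p hp f • evalFiber L s p hp := by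
  rw [evalFiber, germ_smul, TensorProduct.tmul_smul]
  exact (algebraMap_smul (X.residueField p) (X.presheaf.germ U p hp f) _).symm

lemma IsFrame.bijective_smul_evalFiber {e : Γ(L, U)} (he : IsFrame L e) :
    Function.Bijective fun a : X.residueField p ↦ a • evalFiber L e p hp :=
  bijective_smul_one_tmul (he.bijective_smul_germ p hp)

lemma evalFiber_smul_ne_zero_iff {e : Γ(L, U)} (he : IsFrame L e) (f : Γ(X, U)) :
    evalFiber L (f • e) p hp ≠ 0 ↔ X.evaluation U p hp f ≠ 0 := by
  rw [evalFiber_smul, not_iff_not]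
  refine ⟨fun h ↦ (he.bijective_smul_evalFiber p hp).1 ?_, fun h ↦ by rw [h, zero_smul]⟩
  exact h.trans (zero_smul _ _).symm

end Fibers

namespace An

variable {A : Type u} [NormedCommRing A] {X : Scheme.{u}} {π : X ⟶ Spec (CommRingCat.of A)}
  {L : X.Modules} {U V : X.Opens} (y : An π) (hy : y.pt ∈ U)

/-- The value `f(y)` in the completed residue field of a regular function `f`. -/
def value (f : Γ(X, U)) : y.ResField := algebraMap _ _ (X.evaluation U y.pt hy f)

lemma norm_value (f : Γ(X, U)) : ‖y.value hy f‖ = y.absVal hy f := by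
  rw [value, absVal]
  exact UniformSpace.Completion.norm_coe (E := WithAbs y.val) _

lemma eval_res (h : V ≤ U) (hy : y.pt ∈ V) (s : Γ(L, U)) :
    y.eval (res L h s) hy = y.eval s (h hy) := by
  rw [eval, eval, evalFiber_res]

lemma eval_smul (f : Γ(X, U)) (s : Γ(L, U)) :
    y.eval (f • s) hy = y.value hy f • y.eval s hy := by
  rw [eval, eval, evalFiber_smul, TensorProduct.tmul_smul, value]
  exact (algebraMap_smul y.ResField _ _).symm

variable {e : Γ(L, U)} (he : IsFrame L e)
include he

lemma bijective_smul_eval : Function.Bijective fun a : y.ResField ↦ a • y.eval e hy :=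
  bijective_smul_one_tmul (he.bijective_smul_evalFiber y.pt hy)

lemma exists_eq_smul_eval (v : y.Fib L) : ∃ a : y.ResField, v = a • y.eval e hy := by
  obtain ⟨a, h⟩ := (y.bijective_smul_eval hy he).2 v
  exact ⟨a, h.symm⟩

lemma smul_eval_injective {a b : y.ResField} (h : a • y.eval e hy = b • y.eval e hy) : a = b :=
  (y.bijective_smul_eval hy he).1 h

lemma eval_ne_zero : y.eval e hy ≠ 0 := fun h ↦
  one_ne_zero (α := y.ResField) (y.smul_eval_injective hy he (by rw [h, smul_zero, smul_zero]))

end An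

/-! ### Continuity of metrics -/

section MetricContinuity

open Filter Topology

variable {A : Type u} [NormedCommRing A] {X Y : Scheme.{u}} {π : X ⟶ Spec (CommRingCat.of A)}
  {ρ : Y ⟶ Spec (CommRingCat.of A)} {L : X.Modules}

namespace An

lemma isOpen_pt_mem (U : X.Opens) : IsOpen {y : An π | y.pt ∈ U} :=
  isOpen_generateFrom_of_mem ⟨U, 0, Set.univ, isOpen_univ, by simp⟩

lemma continuous_absVal (U : X.Opens) (f : Γ(X, U)) :
    Continuous fun y : {y : An π // y.pt ∈ U} ↦ y.1.absVal y.2 f := by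
  refine continuous_def.mpr fun W hW ↦ ?_
  convert (isOpen_generateFrom_of_mem ⟨U, f, W, hW, rfl⟩ :
    IsOpen {y : An π | ∃ hy : y.pt ∈ U, y.absVal hy f ∈ W}).preimage continuous_subtype_val
    using 1
  ext ⟨y, hy⟩
  simp [hy]

lemma continuous_map (g : X ⟶ Y) (hg : g ≫ ρ = π) : Continuous (An.map (ρ := ρ) g hg) := by
  refine continuous_generateFrom_iff.mpr ?_
  rintro _ ⟨U, f, W, hW, rfl⟩
  refine isOpen_generateFrom_of_mem ⟨g ⁻¹ᵁ U, g.app U f, W, hW, ?_⟩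
  ext y
  constructor
  · rintro ⟨h1, h2⟩
    exact ⟨h1, Set.mem_of_eq_of_mem (absVal_map_app g hg y h1 f).symm h2⟩
  · rintro ⟨h1, h2⟩
    exact ⟨h1, Set.mem_of_eq_of_mem (absVal_map_app g hg y h1 f) h2⟩

lemma continuous_of_locally {T : Type*} [TopologicalSpace T] {F : An π → T}
    (h : ∀ y : An π, ∃ U : X.Opens, y.pt ∈ U ∧ Continuous fun z : {z : An π // z.pt ∈ U} ↦ F z.1) :
    Continuous F := by
  refine continuous_iff_continuousAt.mpr fun y ↦ ?_
  obtain ⟨U, hy, hF⟩ := h y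
  exact ((isOpen_pt_mem U).isOpenEmbedding_subtypeVal.continuousAt_iff (x := ⟨y, hy⟩)).mp
    hF.continuousAt

end An

lemma IsLineBundle.exists_ne_zero (hL : IsLineBundle L) (y : An π) : ∃ v : y.Fib L, v ≠ 0 := by
  obtain ⟨U, hy, e, he⟩ := hL y.pt
  exact ⟨_, y.eval_ne_zero hy he⟩

lemma IsLineBundle.exists_eq_smul (hL : IsLineBundle L) (y : An π) {v w : y.Fib L} (hv : v ≠ 0) :
    ∃ a : y.ResField, w = a • v := by
  obtain ⟨U, hy, e, he⟩ := hL y.pt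
  obtain ⟨a, rfl⟩ := y.exists_eq_smul_eval hy he v
  obtain ⟨b, rfl⟩ := y.exists_eq_smul_eval hy he w
  have ha : a ≠ 0 := by rintro rfl; exact hv (zero_smul _ _)
  exact ⟨b * a⁻¹, by rw [smul_smul, mul_assoc, inv_mul_cancel₀ ha, mul_one]⟩

namespace Metric

variable (φ ψ : Metric π L) {U : X.Opens}

lemma norm_pos {y : An π} {v : y.Fib L} (hv : v ≠ 0) : 0 < φ.norm y v := (φ.isLineNorm y).1 v hv

lemma norm_smul {y : An π} (a : y.ResField) (v : y.Fib L) :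
    φ.norm y (a • v) = ‖a‖ * φ.norm y v := (φ.isLineNorm y).2 a v

/-- The value at a nonzero vector `v` of the weight `-log ‖·‖`. -/
def logNorm {y : An π} (v : y.Fib L) : ℝ := -Real.log (φ.norm y v)

lemma logNorm_smul {y : An π} {a : y.ResField} (ha : a ≠ 0) {v : y.Fib L} (hv : v ≠ 0) :
    φ.logNorm (a • v) = φ.logNorm v - Real.log ‖a‖ := by
  rw [logNorm, logNorm, norm_smul, Real.log_mul (norm_ne_zero_iff.mpr ha) (φ.norm_pos hv).ne']
  ring

open scoped Classical in
/-- The function `φ - ψ` on `X^an`. -/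
def diff (y : An π) : ℝ :=
  if h : ∃ v : y.Fib L, v ≠ 0 then φ.logNorm h.choose - ψ.logNorm h.choose else 0

variable {φ ψ}

/-- Rescaling the vector changes both weights by the same `log ‖a‖`, so the difference is
independent of the vector chosen in the definition. -/
lemma diff_eq (hL : IsLineBundle L) {y : An π} {v : y.Fib L} (hv : v ≠ 0) :
    φ.diff ψ y = φ.logNorm v - ψ.logNorm v := by
  have h : ∃ v : y.Fib L, v ≠ 0 := ⟨v, hv⟩
  rw [diff, dif_pos h]
  have hw := h.choose_spec
  generalize h.choose = w at hw
  obtain ⟨a, rfl⟩ := hL.exists_eq_smul y (w := v) hw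
  have ha : a ≠ 0 := by rintro rfl; exact hv (zero_smul _ _)
  rw [logNorm_smul _ ha hw, logNorm_smul _ ha hw]
  ring

lemma continuous_logNorm_eval (hφ : φ.IsContinuous) {e : Γ(L, U)} (he : IsFrame L e) :
    Continuous fun y : {y : An π // y.pt ∈ U} ↦ φ.logNorm (y.1.eval e y.2) :=
  ((hφ U e).log fun y ↦ (φ.norm_pos (y.1.eval_ne_zero y.2 he)).ne').neg

/-- Locally `s = f • e`, so `‖s‖` is the product of the continuous function `|f|` with `‖e‖`. -/
lemma isContinuous_of_frames (h : ∀ p : X, ∃ (U : X.Opens) (_ : p ∈ U) (e : Γ(L, U)), IsFrame L e ∧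
    Continuous fun y : {y : An π // y.pt ∈ U} ↦ φ.logNorm (y.1.eval e y.2)) : φ.IsContinuous := by
  intro V s
  refine continuous_iff_continuousAt.mpr ?_
  rintro ⟨y, hy⟩
  obtain ⟨U, hyU, e, he, hc⟩ := h y.pt
  obtain ⟨f, hf⟩ := he.exists_smul (V := V ⊓ U) inf_le_right (res L inf_le_left s)
  have hc' : Continuous fun z : {z : An π // z.pt ∈ V ⊓ U} ↦
      φ.norm z.1 (z.1.eval s z.2.1) := by
    have key : ∀ z : {z : An π // z.pt ∈ V ⊓ U}, φ.norm z.1 (z.1.eval s z.2.1) =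
        z.1.absVal z.2 f * Real.exp (-φ.logNorm (z.1.eval e z.2.2)) := fun z ↦ by
      rw [← An.eval_res z.1 (inf_le_left : V ⊓ U ≤ V) z.2 s, ← hf, An.eval_smul, norm_smul,
        An.norm_value, An.eval_res, logNorm, neg_neg,
        Real.exp_log (φ.norm_pos (z.1.eval_ne_zero z.2.2 he))]
    simp_rw [key]
    refine (An.continuous_absVal (V ⊓ U) f).mul (hc.comp (f := fun z : {z : An π // z.pt ∈ V ⊓ U} ↦
      (⟨z.1, z.2.2⟩ : {z : An π // z.pt ∈ U})) (by fun_prop)).neg.rexp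
  have hemb : IsOpenEmbedding fun z : {z : An π // z.pt ∈ V ⊓ U} ↦
      (⟨z.1, z.2.1⟩ : {z : An π // z.pt ∈ V}) :=
    .of_comp _ (An.isOpen_pt_mem V).isOpenEmbedding_subtypeVal
      (An.isOpen_pt_mem (V ⊓ U)).isOpenEmbedding_subtypeVal
  exact (hemb.continuousAt_iff (x := ⟨y, hy, hyU⟩)).mp hc'.continuousAt

lemma continuous_diff (hL : IsLineBundle L) (hφ : φ.IsContinuous) (hψ : ψ.IsContinuous) :
    Continuous (φ.diff ψ) := by
  refine An.continuous_of_locally fun y ↦ ?_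
  obtain ⟨U, hy, e, he⟩ := hL y.pt
  refine ⟨U, hy, ((continuous_logNorm_eval hφ he).sub (continuous_logNorm_eval hψ he)).congr ?_⟩
  exact fun z ↦ (diff_eq hL (z.1.eval_ne_zero z.2 he)).symm

lemma isContinuous_of_continuous_diff (hL : IsLineBundle L) (hψ : ψ.IsContinuous)
    (h : Continuous (φ.diff ψ)) : φ.IsContinuous := by
  refine isContinuous_of_frames fun p ↦ ?_
  obtain ⟨U, hy, e, he⟩ := hL p
  refine ⟨U, hy, e, he, ((h.comp continuous_subtype_val).add (continuous_logNorm_eval hψ he)).congr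
    fun z ↦ ?_⟩
  simp [diff_eq hL (z.1.eval_ne_zero z.2 he)]

lemma diff_add_diff (hL : IsLineBundle L) (χ : Metric π L) (y : An π) :
    φ.diff ψ y + ψ.diff χ y = φ.diff χ y := by
  obtain ⟨v, hv⟩ := hL.exists_ne_zero y
  rw [diff_eq hL hv, diff_eq hL hv, diff_eq hL hv, sub_add_sub_cancel]

variable (φ) in
/-- The metric `φ + c`. -/
def shift (c : ℝ) : Metric π L where
  norm y v := Real.exp (-c) * φ.norm y v
  isLineNorm y := ⟨fun v hv ↦ mul_pos (Real.exp_pos _) (φ.norm_pos hv), fun a v ↦ by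
    simp only [norm_smul]; ring⟩

lemma logNorm_shift (c : ℝ) {y : An π} {v : y.Fib L} (hv : v ≠ 0) :
    (φ.shift c).logNorm v = φ.logNorm v + c := by
  rw [logNorm, shift, Real.log_mul (Real.exp_pos _).ne' (φ.norm_pos hv).ne', Real.log_exp, logNorm]
  ring

lemma IsContinuous.shift (hφ : φ.IsContinuous) (c : ℝ) : (φ.shift c).IsContinuous :=
  fun U s ↦ (hφ U s).const_mul _

end Metric

lemma compactlyConverges_iff (hL : IsLineBundle L) {I : Type u} [Preorder I] {ψ : I → Metric π L}
    {φ : Metric π L} : CompactlyConverges ψ φ ↔ ∀ K : Set (An π), IsCompact K → ∀ ε : ℝ, 0 < ε →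
      ∃ i₀, ∀ i, i₀ ≤ i → ∀ y ∈ K, |(ψ i).diff φ y| < ε := by
  refine forall₄_congr fun K _ ε _ ↦ exists_congr fun i₀ ↦ forall₄_congr fun i _ y _ ↦ ?_
  refine ⟨fun h ↦ ?_, fun h v hv ↦ ?_⟩
  · obtain ⟨v, hv⟩ := hL.exists_ne_zero y
    rw [Metric.diff_eq hL hv]
    exact h v hv
  · rw [Metric.diff_eq hL hv] at h
    exact h

/-- A decreasing net of continuous metrics with continuous limit converges compactly. -/
theorem compactlyConverges_of_antitone (hL : IsLineBundle L) {I : Type u} [Preorder I]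
    [IsDirectedOrder I] [Nonempty I] {ψ : I → Metric π L} {φ : Metric π L}
    (hψ : ∀ i, (ψ i).IsContinuous) (hφ : φ.IsContinuous)
    (hanti : ∀ i j, i ≤ j → ∀ (y : An π) (v : y.Fib L), v ≠ 0 →
      (ψ j).toSingular.weight y v ≤ (ψ i).toSingular.weight y v)
    (hlim : ∀ (y : An π) (v : y.Fib L), v ≠ 0 →
      Tendsto (fun i ↦ (ψ i).toSingular.weight y v) atTop (𝓝 (φ.toSingular.weight y v))) :
    CompactlyConverges ψ φ := by
  refine (compactlyConverges_iff hL).mpr fun K hK ε hε ↦ ?_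
  -- Dini's theorem, applied to the differences with `φ`.
  have := Antitone.tendstoUniformlyOn_of_forall_tendsto (F := fun i y ↦ (ψ i).diff φ y)
    (f := fun _ ↦ 0) hK (fun i ↦ (Metric.continuous_diff hL (hψ i) hφ).continuousOn)
    (fun y _ i j hij ↦ ?_) continuousOn_const fun y _ ↦ ?_
  · obtain ⟨i₀, h⟩ := eventually_atTop.mp (_root_.Metric.tendstoUniformlyOn_iff.mp this ε hε)
    exact ⟨i₀, fun i hi y hy ↦ by simpa using h i hi y hy⟩
  · obtain ⟨v, hv⟩ := hL.exists_ne_zero y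
    simp only [Metric.diff_eq hL hv]
    exact sub_le_sub_right (EReal.coe_le_coe_iff.mp (hanti i j hij y v hv)) _
  · obtain ⟨v, hv⟩ := hL.exists_ne_zero y
    have h : Tendsto (fun i ↦ (ψ i).logNorm v) atTop (𝓝 (φ.logNorm v)) :=
      EReal.tendsto_coe.mp (hlim y v hv)
    simpa only [Metric.diff_eq hL hv, sub_self] using h.sub_const (φ.logNorm v)

end MetricContinuity

/-! ### A projective variety as a model of itself -/

section SelfModel

/-- For a reflector `F`, an isomorphism of `P` with an object `Y` of the reflective subcategory
induces an isomorphism from the reflection of `P` to `Y`. -/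
def reflectIso {C D : Type*} [Category* C] [Category* D] {F : C ⥤ D} {G : D ⥤ C}
    (adj : F ⊣ G) [IsIso adj.counit] {P : C} {Y : D} (i : P ≅ G.obj Y) : F.obj P ≅ Y :=
  F.mapIso i ≪≫ asIso (adj.counit.app Y)

/-- A triangle identity. It computes `tensorPowOneIso` on the sections `s ^ ⊗ 1`, which come from
the presheaf through the unit. -/
lemma unit_reflectIso {C D : Type*} [Category* C] [Category* D] {F : C ⥤ D} {G : D ⥤ C}
    (adj : F ⊣ G) [IsIso adj.counit] {P : C} {Y : D} (i : P ≅ G.obj Y) :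
    adj.unit.app P ≫ G.map (reflectIso adj i).hom = i.hom := by
  simp [reflectIso]

variable {X : Scheme.{u}} (L : X.Modules)

/-- The first tensor power of `L` is `L`, before sheafification. -/
def presheafPowOneIso : presheafPow L.val 1 ≅
    (SheafOfModules.forget X.ringCatSheaf ⋙
      PresheafOfModules.restrictScalars (𝟙 X.ringCatSheaf.obj)).obj L :=
  MonoidalCategory.leftUnitor
    (C := PresheafOfModules.{u} (X.presheaf ⋙ forget₂ CommRingCat RingCat)) L.val

/-- The first tensor power of `L` is `L`. -/
def tensorPowOneIso : tensorPow L 1 ≅ L :=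
  reflectIso (PresheafOfModules.sheafificationAdjunction (𝟙 X.ringCatSheaf.obj))
    (presheafPowOneIso L)

lemma presheafPowOneIso_hom_app {V : X.Opens} (s : Γ(L, V)) :
    ((presheafPowOneIso L).hom.app (op V)).hom (presheafPowSection L.val s 1) = s :=
  one_smul Γ(X, V) s

lemma tensorPowOneIso_hom_app {V : X.Opens} (s : Γ(L, V)) :
    (tensorPowOneIso L).hom.app V (tensorPowSection L s 1) = s := by
  have h := unit_reflectIso (PresheafOfModules.sheafificationAdjunction (𝟙 X.ringCatSheaf.obj))
    (presheafPowOneIso L)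
  exact (congrArg (fun g : presheafPow L.val 1 ⟶ (SheafOfModules.forget X.ringCatSheaf ⋙
    PresheafOfModules.restrictScalars (𝟙 X.ringCatSheaf.obj)).obj L ↦
    (g.app (op V)).hom (presheafPowSection L.val s 1)) h).trans (presheafPowOneIso_hom_app L s)

variable {A : Type u} [NormedCommRing A] {π : X ⟶ Spec (CommRingCat.of A)} {L}

/-- A projective variety is a model of itself. -/
def ProjectiveModel.self (hvar : IsVariety π) (hproj : IsProjective π) (hL : IsLineBundle L) :
    ProjectiveModel π L where
  X := X
  toSpec := π
  isVariety := hvar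
  isProjective := hproj
  emb := 𝟙 X
  isOpenImmersion := inferInstance
  emb_toSpec := Category.id_comp π
  qBundle := ⟨L, hL, 1, one_pos⟩
  iso := Scheme.Modules.restrictFunctorId.app L ≪≫ (tensorPowOneIso L).symm

lemma An.map_id (y : An π) : y.map (𝟙 X) (Category.id_comp π) = y :=
  An.ext rfl (heq_of_eq (AbsoluteValue.ext fun a ↦
    congr(y.val ($(Scheme.residueFieldMap_id y.pt).hom a))))

lemma selfIso_inv_app {V : X.Opens} (s : Γ(L, V)) :
    (Scheme.Modules.restrictFunctorId.app L ≪≫ (tensorPowOneIso L).symm).inv.app V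
      (tensorPowSection L s 1) = res L (show 𝟙 X ''ᵁ V ≤ V by simp) s := by
  rw [Iso.trans_inv, Scheme.Modules.Hom.comp_app, ConcreteCategory.comp_apply]
  exact congrArg (fun t : Γ(L, V) ↦ (Scheme.Modules.restrictFunctorId.inv.app L).app V t)
    (tensorPowOneIso_hom_app L s)

lemma ProjectiveModel.self_isRestriction (hvar : IsVariety π) (hproj : IsProjective π)
    (hL : IsLineBundle L) (φ : Metric π L) :
    (ProjectiveModel.self hvar hproj hL).IsRestriction φ φ := by
  intro V e he y hy
  have h1 : (ProjectiveModel.self hvar hproj hL).powSection e =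
      res L (show 𝟙 X ''ᵁ V ≤ V by simp) e := selfIso_inv_app e
  rw [h1]
  -- The image of `y` under the identity is equal to `y` only propositionally, and the fibres depend
  -- on the point; quantifying over `z` allows substitution.
  have h2 : ∀ z : An π, z = y → ∀ hz : z.pt ∈ 𝟙 X ''ᵁ V, φ.norm z (z.eval (res L (show 𝟙 X ''ᵁ V ≤ V by simp) e) hz) =
      φ.norm y (y.eval e hy) := by
    rintro _ rfl hz
    rw [An.eval_res]
  have h3 := h2 _ (An.map_id y) (Set.mem_image_of_mem _ hy)
  change _ = ((1 : ℕ) : ℝ)⁻¹ * -Real.log (φ.norm _ _)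
  rw [Nat.cast_one, inv_one, one_mul]
  exact congrArg (fun t ↦ -Real.log t) h3.symm

/-- A continuous plurisubharmonic metric on a line bundle over a projective variety is continuous
semipositive. -/
theorem Metric.IsContinuousPSH.isContinuousSemipositive (hvar : IsVariety π)
    (hproj : IsProjective π) (hL : IsLineBundle L) {φ : Metric π L} (h : φ.IsContinuousPSH) :
    φ.IsContinuousSemipositive := by
  obtain ⟨hφ, ⟨I, _, _, _, ψ, hψ, hanti, hlim⟩, -⟩ := h
  exact ⟨I, _, ‹_›, ‹_›, fun _ ↦ ProjectiveModel.self hvar hproj hL, ψ, ψ, hψ,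
    fun i ↦ ProjectiveModel.self_isRestriction hvar hproj hL (ψ i),
    compactlyConverges_of_antitone hL (fun i ↦ (hψ i).1) hφ hanti hlim⟩

end SelfModel

/-! ### Transfer of sections from a model -/

section Transfer

variable {A : Type u} [NormedCommRing A] {S : Scheme.{u}} {π : S ⟶ Spec (CommRingCat.of A)}
  {L : S.Modules}

namespace ProjectiveModel

variable (M : ProjectiveModel π L) {V W : S.Opens}

/-- Pullback of regular functions from a model. -/
def pull (f : Γ(M.X, M.emb ''ᵁ V)) : Γ(S, V) := (M.emb.appIso V).hom f

/-- Extension of regular functions to a model. -/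
def push (f : Γ(S, V)) : Γ(M.X, M.emb ''ᵁ V) := (M.emb.appIso V).inv f

lemma pull_push (f : Γ(S, V)) : M.pull (M.push f) = f := by simp [pull, push]

lemma push_pull (f : Γ(M.X, M.emb ''ᵁ V)) : M.push (M.pull f) = f := by simp [pull, push]

lemma pull_mul (f g : Γ(M.X, M.emb ''ᵁ V)) : M.pull (f * g) = M.pull f * M.pull g := by
  simp [pull]

lemma pull_pow (f : Γ(M.X, M.emb ''ᵁ V)) (n : ℕ) : M.pull (f ^ n) = M.pull f ^ n := by
  simp [pull]

lemma image_le (h : W ≤ V) : M.emb ''ᵁ W ≤ M.emb ''ᵁ V := Scheme.Hom.image_mono _ h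

lemma emb_mem_image {p : S} (hp : p ∈ V) : M.emb p ∈ M.emb ''ᵁ V := Set.mem_image_of_mem _ hp

lemma anMap_pt_mem {y : An π} (hy : y.pt ∈ V) : (M.anMap y).pt ∈ M.emb ''ᵁ V :=
  M.emb_mem_image hy

lemma pull_fres (h : W ≤ V) (f : Γ(M.X, M.emb ''ᵁ V)) :
    M.pull (fres (M.image_le h) f) = fres h (M.pull f) :=
  congr($(M.emb.appIso_hom_naturality (homOfLE h).op) f)

lemma evaluation_pull (p : S) (hp : p ∈ V) (f : Γ(M.X, M.emb ''ᵁ V)) :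
    S.evaluation V p hp (M.pull f) = (M.emb.residueFieldMap p).hom
      (M.X.evaluation (M.emb ''ᵁ V) (M.emb p) (M.emb_mem_image hp) f) := by
  refine Eq.trans ?_ (Scheme.evaluation_naturality_apply M.emb p (M.emb_mem_image hp) f).symm
  rw [pull, Scheme.Hom.appIso_hom, ConcreteCategory.comp_apply]
  exact evaluation_map (M.emb.preimage_image_eq V).ge p hp _

lemma absVal_anMap (y : An π) (hy : y.pt ∈ V) (f : Γ(M.X, M.emb ''ᵁ V)) :
    (M.anMap y).absVal (M.anMap_pt_mem hy) f = y.absVal hy (M.pull f) :=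
  congrArg y.val (M.evaluation_pull y.pt hy f).symm

/-- The identification of the sections of a tensor power of `L` with those of the bundle of the
model. -/
def toModel (t : Γ(tensorPow L M.qBundle.denom, V)) : Γ(M.qBundle.bundle, M.emb ''ᵁ V) :=
  (M.qBundle.bundle.restrictAppIso M.emb V).hom (M.iso.inv.app V t)

lemma toModel_smul (f : Γ(S, V)) (t : Γ(tensorPow L M.qBundle.denom, V)) :
    M.toModel (f • t) = M.push f • M.toModel t := by
  rw [toModel, Scheme.Modules.Hom.app_smul]
  rfl

lemma toModel_res (h : W ≤ V) (t : Γ(tensorPow L M.qBundle.denom, V)) :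
    M.toModel (res _ h t) = res M.qBundle.bundle (M.image_le h) (M.toModel t) :=
  congr($(M.iso.inv.mapPresheaf.naturality (homOfLE h).op) t)

lemma bijective_toModel :
    Function.Bijective (M.toModel : Γ(tensorPow L M.qBundle.denom, V) → _) :=
  ConcreteCategory.bijective_of_isIso (M.iso.inv.app V)

lemma bijective_pull : Function.Bijective (M.pull : Γ(M.X, M.emb ''ᵁ V) → Γ(S, V)) :=
  ConcreteCategory.bijective_of_isIso (M.emb.appIso V).hom

lemma powSection_smul (f : Γ(S, V)) (s : Γ(L, V)) :
    M.powSection (f • s) = M.push f ^ M.qBundle.denom • M.powSection s := by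
  refine (congrArg M.toModel (tensorPowSection_smul _ f s)).trans ?_
  rw [toModel_smul, push, map_pow]
  rfl

lemma powSection_res (h : W ≤ V) (s : Γ(L, V)) :
    M.powSection (res L h s) = res M.qBundle.bundle (M.image_le h) (M.powSection s) :=
  (congrArg M.toModel (res_tensorPowSection _ h s)).symm.trans (M.toModel_res h _)

/-- Every open subset of the image of `V` is itself an image, and there multiplication by the
section is the multiplication by `e ^ ⊗ n` on `L ^ ⊗ n` transported along bijections. -/
lemma isFrame_powSection {e : Γ(L, V)} (he : IsFrame L e) :
    IsFrame M.qBundle.bundle (M.powSection e) := by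
  intro W hW
  obtain ⟨W, rfl⟩ : ∃ W', W = M.emb ''ᵁ W' := ⟨M.emb ⁻¹ᵁ W, by
    rw [Scheme.Hom.image_preimage_eq_opensRange_inf, right_eq_inf]
    exact hW.trans (Scheme.Hom.image_le_opensRange _ _)⟩
  replace hW : W ≤ V := (M.emb.image_le_image_iff W V).mp hW
  change Function.Bijective fun f : Γ(M.X, M.emb ''ᵁ W) ↦
    f • res M.qBundle.bundle (M.image_le hW) (M.powSection e)
  rw [← powSection_res]
  convert M.bijective_toModel.comp (((he.tensorPowSection M.qBundle.denom) W hW).comp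
    M.bijective_pull) using 1
  funext f
  change _ = M.toModel (M.pull f • res _ hW (tensorPowSection L e M.qBundle.denom))
  rw [toModel_smul, push_pull, res_tensorPowSection]
  rfl

variable {m : ℕ}

/-- The section of a tensor power of the bundle of the model defined by a frame. -/
abbrev powFrame (e : Γ(L, V)) (m : ℕ) : Γ(tensorPow M.qBundle.bundle m, M.emb ''ᵁ V) :=
  tensorPowSection M.qBundle.bundle (M.powSection e) m

lemma isFrame_powFrame {e : Γ(L, V)} (he : IsFrame L e) (m : ℕ) :
    IsFrame (tensorPow M.qBundle.bundle m) (M.powFrame e m) :=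
  (M.isFrame_powSection he).tensorPowSection m

lemma powFrame_smul (f : Γ(S, V)) (e : Γ(L, V)) (m : ℕ) :
    M.powFrame (f • e) m = M.push f ^ (M.qBundle.denom * m) • M.powFrame e m := by
  rw [powFrame, powSection_smul, tensorPowSection_smul, ← pow_mul]

lemma powFrame_res (h : W ≤ V) (e : Γ(L, V)) (m : ℕ) :
    M.powFrame (res L h e) m =
      res (tensorPow M.qBundle.bundle m) (M.image_le h) (M.powFrame e m) := by
  rw [powFrame, powSection_res, res_tensorPowSection]

lemma exists_eq_smul_powFrame (s : Γ(tensorPow M.qBundle.bundle m, ⊤)) {e : Γ(L, V)}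
    (he : IsFrame L e) : ∃ f : Γ(M.X, M.emb ''ᵁ V),
      res (tensorPow M.qBundle.bundle m) le_top s = f • M.powFrame e m := by
  obtain ⟨f, hf⟩ := (M.isFrame_powFrame he m).exists_smul le_rfl
    (res (tensorPow M.qBundle.bundle m) le_top s)
  refine ⟨f, hf.symm.trans (congrArg (f • ·) ?_)⟩
  exact congr($((tensorPow M.qBundle.bundle m).presheaf.map_id _) _)

/-- A change of frame `e' = u e` multiplies both `M.powFrame e m` and `e ^ ⊗ nm` by the `nm`-th
power of `u`. Coefficients in the two bundles thus obey the same transition rule, and no isomorphism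
between `(L ^ ⊗ n) ^ ⊗ m` and `L ^ ⊗ nm` is needed. -/
lemma pull_smul_tensorPowSection_eq {e e' : Γ(L, V)} (he : IsFrame L e)
    {f f' : Γ(M.X, M.emb ''ᵁ V)} (h : f • M.powFrame e m = f' • M.powFrame e' m) :
    M.pull f • tensorPowSection L e (M.qBundle.denom * m) =
      M.pull f' • tensorPowSection L e' (M.qBundle.denom * m) := by
  obtain ⟨u, hu⟩ := he.exists_smul le_rfl e'
  replace hu : u • e = e' := by
    rw [← hu]
    exact congrArg (u • ·) congr($(L.presheaf.map_id _) e).symm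
  subst hu
  rw [powFrame_smul, smul_smul] at h
  have h' : f = f' * M.push u ^ (M.qBundle.denom * m) := by
    refine (M.isFrame_powFrame he m).smul_injective le_rfl ?_
    have := congr($((tensorPow M.qBundle.bundle m).presheaf.map_id _) (M.powFrame e m))
    exact ((congrArg (f • ·) this).trans h).trans (congrArg (_ • ·) this).symm
  rw [h', pull_mul, pull_pow, pull_push, tensorPowSection_smul, smul_smul]

lemma res_smul_powFrame (h : W ≤ V) {e : Γ(L, V)} {f : Γ(M.X, M.emb ''ᵁ V)}
    {s : Γ(tensorPow M.qBundle.bundle m, ⊤)}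
    (hs : res (tensorPow M.qBundle.bundle m) le_top s = f • M.powFrame e m) :
    res (tensorPow M.qBundle.bundle m) le_top s =
      fres (M.image_le h) f • M.powFrame (res L h e) m := by
  rw [powFrame_res, ← res_smul, ← hs, res_res]

/-- The section of `L^{⊗ nm}` defined by a section of the `m`-th power of the bundle of a model. -/
theorem exists_section (hL : IsLineBundle L) (s : Γ(tensorPow M.qBundle.bundle m, ⊤)) :
    ∃ t : Γ(tensorPow L (M.qBundle.denom * m), ⊤), ∀ (V : S.Opens) (e : Γ(L, V)), IsFrame L e →
      ∀ f : Γ(M.X, M.emb ''ᵁ V), res (tensorPow M.qBundle.bundle m) le_top s = f • M.powFrame e m →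
        res (tensorPow L (M.qBundle.denom * m)) le_top t =
          M.pull f • tensorPowSection L e (M.qBundle.denom * m) := by
  choose V hV e he using hL
  choose f hf using fun p ↦ M.exists_eq_smul_powFrame s (he p)
  -- Used twice: to glue the local sections, and to show that the glued section has the required
  -- form in every frame.
  have key : ∀ (p : S) (W : S.Opens) (e' : Γ(L, W)), IsFrame L e' →
      ∀ f' : Γ(M.X, M.emb ''ᵁ W),
      res (tensorPow M.qBundle.bundle m) le_top s = f' • M.powFrame e' m →
      res (tensorPow L (M.qBundle.denom * m)) (inf_le_left : V p ⊓ W ≤ V p)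
        (M.pull (f p) • tensorPowSection L (e p) (M.qBundle.denom * m)) =
      res (tensorPow L (M.qBundle.denom * m)) (inf_le_right : V p ⊓ W ≤ W)
        (M.pull f' • tensorPowSection L e' (M.qBundle.denom * m)) := by
    intro p W e' he' f' hf'
    rw [res_smul, res_smul, res_tensorPowSection, res_tensorPowSection, ← pull_fres, ← pull_fres]
    exact M.pull_smul_tensorPowSection_eq ((he p).res inf_le_left)
      ((M.res_smul_powFrame inf_le_left (hf p)).symm.trans (M.res_smul_powFrame inf_le_right hf'))
  obtain ⟨t, ht⟩ := exists_gluing (tensorPow L (M.qBundle.denom * m)) (U := ⊤) V (fun _ ↦ le_top)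
    (fun p _ ↦ Opens.mem_iSup.mpr ⟨p, hV p⟩)
    (fun p ↦ M.pull (f p) • tensorPowSection L (e p) (M.qBundle.denom * m))
    fun p q ↦ key p (V q) (e q) (he q) (f q) (hf q)
  refine ⟨t, fun W e' he' f' hf' ↦ eq_of_locally_res_eq _ _ _ fun p hp ↦
    ⟨V p ⊓ W, inf_le_right, ⟨hV p, hp⟩, ?_⟩⟩
  rw [← key p W e' he' f' hf', ← ht p, res_res, res_res]

end ProjectiveModel

end Transfer

/-! ### Restrictions of tropical Fubini–Study metrics -/

section Restriction

variable {A : Type u} [NormedCommRing A]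

lemma iSup_add_coe {ι : Type*} (f : ι → EReal) (r : ℝ) :
    ⨆ i, (f i + (r : EReal)) = (⨆ i, f i) + (r : EReal) := by
  refine le_antisymm (iSup_le fun i ↦ add_le_add_left (le_iSup f i) _) ?_
  rw [← EReal.sub_add_cancel (a := ⨆ i, (f i + (r : EReal))) (b := r)]
  refine add_le_add_left (iSup_le fun i ↦ ?_) _
  rw [← EReal.add_sub_cancel_right (a := f i) (b := r)]
  exact EReal.sub_le_sub (le_iSup (fun i ↦ f i + (r : EReal)) i) le_rfl

lemma log_enorm_mul_inv {K : Type*} [NormedField K] (a : K) {b : K} (hb : b ≠ 0) :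
    ENNReal.log ‖a * b⁻¹‖ₑ = ENNReal.log ‖a‖ₑ + ((-Real.log ‖b‖ : ℝ) : EReal) := by
  rw [enorm_mul, ENNReal.log_mul_add, ← ofReal_norm b⁻¹,
    ENNReal.log_ofReal_of_pos (norm_pos_iff.mpr (inv_ne_zero hb)), norm_inv, Real.log_inv]

section LogAbs

variable {X : Scheme.{u}} {π : X ⟶ Spec (CommRingCat.of A)} {N : X.Modules} {V : X.Opens}

/-- In a local frame `g` of `N`, the function `log |s|` is given by the coordinate of `s`. -/
lemma logAbs_smul_eval {y : An π} (hy : y.pt ∈ V) {g : Γ(N, V)} (hg : IsFrame N g) {s : Γ(N, ⊤)}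
    {f : Γ(X, V)} (hs : res N le_top s = f • g) {b : y.ResField} (hb : b ≠ 0) :
    logAbs s y (b • y.eval g hy) =
      ENNReal.log ‖y.value hy f‖ₑ + ((-Real.log ‖b‖ : ℝ) : EReal) := by
  have h : y.eval s (by trivial) = y.value hy f • y.eval g hy := by
    rw [← An.eval_smul, ← hs, An.eval_res]
  rw [← log_enorm_mul_inv _ hb, logAbs]
  refine le_antisymm (iSup₂_le fun c hc ↦ ?_) (le_iSup₂_of_le (y.value hy f * b⁻¹) ?_ le_rfl)
  · rw [h, smul_smul] at hc
    rw [← y.smul_eval_injective hy hg hc, mul_assoc, mul_inv_cancel₀ hb, mul_one]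
  · rw [h, smul_smul, mul_assoc, inv_mul_cancel₀ hb, mul_one]

end LogAbs

variable {S : Scheme.{u}} {π : S ⟶ Spec (CommRingCat.of A)} {L : S.Modules}
  {M : ProjectiveModel π L}

namespace ProjectiveModel

lemma enorm_value_pull {V : S.Opens} (y : An π) (hy : y.pt ∈ V) (f : Γ(M.X, M.emb ''ᵁ V)) :
    ‖(M.anMap y).value (M.anMap_pt_mem hy) f‖ₑ = ‖y.value hy (M.pull f)‖ₑ := by
  rw [← ofReal_norm, ← ofReal_norm, An.norm_value, An.norm_value, absVal_anMap]

lemma evaluation_pull_ne_zero_iff {V : S.Opens} (p : S) (hp : p ∈ V) (f : Γ(M.X, M.emb ''ᵁ V)) :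
    S.evaluation V p hp (M.pull f) ≠ 0 ↔
      M.X.evaluation (M.emb ''ᵁ V) (M.emb p) (M.emb_mem_image hp) f ≠ 0 := by
  rw [evaluation_pull]
  exact map_ne_zero_iff _ (RingHom.injective _)

variable {Φ : Metric M.toSpec M.qBundle.bundle} {ψ : Metric π L}

lemma IsRestriction.isContinuous (h : M.IsRestriction Φ ψ) (hL : IsLineBundle L)
    (hΦ : Φ.IsContinuous) : ψ.IsContinuous := by
  refine Metric.isContinuous_of_frames fun p ↦ ?_
  obtain ⟨V, hp, e, he⟩ := hL p
  refine ⟨V, hp, e, he, ?_⟩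
  have h1 := Metric.continuous_logNorm_eval hΦ (M.isFrame_powSection he)
  have h2 : Continuous fun y : {y : An π // y.pt ∈ V} ↦
      (⟨M.anMap y.1, M.anMap_pt_mem y.2⟩ :
        {z : An M.toSpec // z.pt ∈ M.emb ''ᵁ V}) :=
    ((An.continuous_map M.emb M.emb_toSpec).comp continuous_subtype_val).subtype_mk _
  exact ((h1.comp h2).const_mul (M.qBundle.denom : ℝ)⁻¹).congr fun y ↦ (h V e he y.1 y.2).symm

/-- Up to an additive constant, the restriction of a tropical Fubini–Study metric from a model is
a tropical Fubini–Study metric. -/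
theorem IsRestriction.isTropicalFS_shift (h : M.IsRestriction Φ ψ) (hL : IsLineBundle L)
    (hΦ : Φ.IsTropicalFS) (c : ℝ) : (ψ.shift c).IsTropicalFS := by
  obtain ⟨hc, m, k, s, l, hm, hs, hΦ⟩ := hΦ
  have hn := M.qBundle.denom_pos
  choose t ht using fun j ↦ M.exists_section hL (s j)
  refine ⟨(h.isContinuous hL hc).shift c, M.qBundle.denom * m, k, t,
    -- Shifting the metric by `c` shifts each `λ_j` by `nm c`, since the maximum is later divided by
    -- `nm`.
    fun j ↦ l j + (M.qBundle.denom * m : ℕ) * c, Nat.mul_pos hn hm, fun p ↦ ?_, ?_⟩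
  · obtain ⟨V, hp, e, he⟩ := hL p
    obtain ⟨j, hj⟩ := hs (M.emb p)
    obtain ⟨f, hf⟩ := M.exists_eq_smul_powFrame (s j) he
    refine ⟨j, ?_⟩
    rw [← evalFiber_res p le_top hp, ht j V e he f hf,
      evalFiber_smul_ne_zero_iff p hp (he.tensorPowSection _), evaluation_pull_ne_zero_iff]
    rwa [← evalFiber_res (M.emb p) le_top (M.emb_mem_image hp), hf,
      evalFiber_smul_ne_zero_iff (M.emb p) _ (M.isFrame_powFrame he m)] at hj
  · rintro y v w hv ⟨V, hy, e, a, he, rfl, rfl⟩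
    have hy' : (M.anMap y).pt ∈ M.emb ''ᵁ V := M.anMap_pt_mem hy
    have ha : a ≠ 0 := by rintro rfl; exact hv (zero_smul _ _)
    have hey := y.eval_ne_zero hy he
    choose f hf using fun j ↦ M.exists_eq_smul_powFrame (s j) he
    -- The formula for `Φ` is evaluated at the frame vector itself, with coefficient 1; the general
    -- vector `a • e` is recovered by homogeneity.
    have h1 : ((Φ.logNorm ((M.anMap y).eval (M.powSection e) hy') : ℝ) : EReal) =
        ((m : ℝ)⁻¹ : ℝ) * ⨆ j, (ENNReal.log ‖y.value hy (M.pull (f j))‖ₑ + ((l j : ℝ) : EReal)) := by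
      refine (hΦ _ _ (1 ^ m • (M.anMap y).eval (M.powFrame e m) hy')
        ((M.anMap y).eval_ne_zero hy' (M.isFrame_powSection he))
        ⟨_, hy', M.powSection e, 1, M.isFrame_powSection he, (one_smul _ _).symm, rfl⟩).trans ?_
      congr 1
      refine iSup_congr fun j ↦ ?_
      rw [one_pow, logAbs_smul_eval hy' (M.isFrame_powFrame he m) (hf j) one_ne_zero, norm_one,
        Real.log_one, neg_zero, EReal.coe_zero, add_zero, enorm_value_pull]
    have h2 : ∀ j, logAbs (t j) y (a ^ (M.qBundle.denom * m) •
        y.eval (tensorPowSection L e (M.qBundle.denom * m)) hy) +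
          ((l j + (M.qBundle.denom * m : ℕ) * c : ℝ) : EReal) =
        ENNReal.log ‖y.value hy (M.pull (f j))‖ₑ + ((l j : ℝ) : EReal) +
          (((M.qBundle.denom * m : ℕ) * (c - Real.log ‖a‖) : ℝ) : EReal) := fun j ↦ by
      rw [logAbs_smul_eval hy (he.tensorPowSection _) (ht j V e he (f j) (hf j)) (pow_ne_zero _ ha),
        norm_pow, Real.log_pow, add_assoc, add_assoc, ← EReal.coe_add, ← EReal.coe_add]
      congr 2
      ring
    have h3 : ψ.logNorm (y.eval e hy) = (M.qBundle.denom : ℝ)⁻¹ *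
        Φ.logNorm ((M.anMap y).eval (M.powSection e) hy') := h V e he y hy
    rw [iSup_congr h2, iSup_add_coe]
    change (((ψ.shift c).logNorm (a • y.eval e hy) : ℝ) : EReal) = _
    rw [Metric.logNorm_shift _ hv, Metric.logNorm_smul _ ha hey, h3]
    generalize (⨆ j, (ENNReal.log ‖y.value hy (M.pull (f j))‖ₑ + ((l j : ℝ) : EReal))) = T at h1
    generalize Φ.logNorm ((M.anMap y).eval (M.powSection e) hy') = x at h1
    have hm' : (0 : ℝ) < m := Nat.cast_pos.mpr hm
    have hn' : (0 : ℝ) < M.qBundle.denom := Nat.cast_pos.mpr hn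
    -- The maximum is finite because its multiple by `m⁻¹` is a real number, so the remaining
    -- identity is one between reals.
    induction T using EReal.rec with
    | bot => simp [EReal.coe_mul_bot_of_pos (inv_pos.mpr hm')] at h1
    | top => simp [EReal.coe_mul_top_of_pos (inv_pos.mpr hm')] at h1
    | coe T =>
      rw [← EReal.coe_mul, EReal.coe_eq_coe_iff] at h1
      rw [← EReal.coe_add, ← EReal.coe_mul, EReal.coe_eq_coe_iff, h1]
      push_cast
      field_simp
      ring

end ProjectiveModel

open Filter Topology

/-- A continuous semipositive metric on a line bundle over a projective variety is continuous
plurisubharmonic. -/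
theorem Metric.IsContinuousSemipositive.isContinuousPSH [IsDomain A]
    (hvar : IsVariety π) (hproj : IsProjective π) (hL : IsLineBundle L) {φ : Metric π L}
    (h : φ.IsContinuousSemipositive) : φ.IsContinuousPSH := by
  obtain ⟨I, _, _, _, M, Φ, ψ, hΦ, hψ, hlim⟩ := h
  have hcpt := hproj.compactSpace
  have hcont : ∀ i, (ψ i).IsContinuous := fun i ↦ (hψ i).isContinuous hL (hΦ i).1
  have happrox : ∀ ε : ℝ, 0 < ε → ∃ i, ∀ y, |(ψ i).diff φ y| < ε := fun ε hε ↦ by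
    obtain ⟨i, hi⟩ := (compactlyConverges_iff hL).mp hlim Set.univ isCompact_univ ε hε
    exact ⟨i, fun y ↦ hi i le_rfl y trivial⟩
  obtain ⟨i₀⟩ := ‹Nonempty I›
  have hφ : φ.IsContinuous := by
    -- Relative to the reference metric `ψ i₀`, uniform approximation of metrics becomes uniform
    -- approximation of the function `φ - ψ i₀` by the continuous functions `ψ i - ψ i₀`.
    refine Metric.isContinuous_of_continuous_diff hL (hcont i₀)
      (continuous_of_uniform_approx_of_continuous fun u hu ↦ ?_)
    obtain ⟨ε, hε, hu⟩ := _root_.Metric.mem_uniformity_dist.mp hu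
    obtain ⟨i, hi⟩ := happrox ε hε
    refine ⟨(ψ i).diff (ψ i₀), Metric.continuous_diff hL (hcont i) (hcont i₀), fun y ↦ hu ?_⟩
    rw [dist_comm, Real.dist_eq, ← Metric.diff_add_diff hL (φ := ψ i) (ψ := φ) (ψ i₀) y, add_sub_cancel_right]
    exact hi y
  -- With errors `4⁻ᵏ` and shifts `2 · 4⁻ᵏ` the sequence decreases: consecutive metrics differ by
  -- less than `(5/4) 4⁻ᵏ`, while the shift drops by `(3/2) 4⁻ᵏ`.
  have hpos : ∀ k : ℕ, (0 : ℝ) < (1 / 4) ^ k := fun k ↦ by positivity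
  choose i hi using fun k : ℕ ↦ happrox ((1 / 4) ^ k) (hpos k)
  have hdist : ∀ (k : ℕ) (y : An π) (v : y.Fib L), v ≠ 0 →
      |(ψ (i k)).logNorm v - φ.logNorm v| < (1 / 4) ^ k := fun k y v hv ↦ by
    rw [← Metric.diff_eq hL hv]
    exact hi k y
  refine ⟨hφ, ⟨ULift.{u} ℕ, inferInstance, inferInstance, inferInstance,
    fun k ↦ (ψ (i k.down)).shift (2 * (1 / 4) ^ k.down),
    fun k ↦ (hψ (i k.down)).isTropicalFS_shift hL (hΦ _) _, fun j k hjk y v hv ↦ ?_,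
    fun y v hv ↦ ?_⟩, fun x hx ↦ ?_⟩
  · have hanti : Antitone fun k : ℕ ↦ ((ψ (i k)).shift (2 * (1 / 4) ^ k)).logNorm v := by
      refine antitone_nat_of_succ_le fun k ↦ ?_
      rw [Metric.logNorm_shift _ hv, Metric.logNorm_shift _ hv]
      have h1 := abs_lt.mp (hdist k y v hv)
      have h2 := abs_lt.mp (hdist (k + 1) y v hv)
      rw [pow_succ] at h2 ⊢
      linarith [hpos k]
    exact EReal.coe_le_coe_iff.mpr (hanti (show j.down ≤ k.down from hjk))
  · refine EReal.tendsto_coe.mpr ?_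
    have h0 : Tendsto (fun k : ℕ ↦ ((1 : ℝ) / 4) ^ k) atTop (𝓝 0) :=
      tendsto_pow_atTop_nhds_zero_of_lt_one (by norm_num) (by norm_num)
    have h1 : Tendsto (fun k : ℕ ↦ (ψ (i k)).logNorm v - φ.logNorm v) atTop (𝓝 0) :=
      squeeze_zero_norm (fun k ↦ (hdist k y v hv).le) h0
    have h2 : Tendsto (fun k : ℕ ↦ ((ψ (i k)).shift (2 * (1 / 4) ^ k)).logNorm v) atTop
        (𝓝 (φ.logNorm v)) := by
      have := (h1.add_const (φ.logNorm v)).add (h0.const_mul 2)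
      rw [zero_add, mul_zero, add_zero] at this
      refine this.congr fun k ↦ ?_
      rw [Metric.logNorm_shift _ hv, sub_add_cancel]
    exact h2.comp (tendsto_atTop_atTop.mpr fun n ↦
      ⟨ULift.up n, fun k hk ↦ show n ≤ k.down from hk⟩ :
        Tendsto (ULift.down : ULift.{u} ℕ → ℕ) atTop atTop)
  -- A metric has real weights at nonzero vectors, so any point of the fibre will do.
  · obtain ⟨y, hy⟩ := hvar.exists_structureMap_eq x hx
    obtain ⟨v, hv⟩ := hL.exists_ne_zero y
    exact ⟨y, v, hy, hv, EReal.coe_ne_bot _⟩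

end Restriction

end BerkovichPSH

end

theorem mainTheorem4 {A : Type u} [NormedCommRing A] [IsDomain A] [CompleteSpace A]
    {X : Scheme.{u}} (π : X ⟶ Spec (CommRingCat.of A))
    (hvar : BerkovichPSH.IsVariety π) (hproj : BerkovichPSH.IsProjective π)
    (L : X.Modules) (hL : BerkovichPSH.IsLineBundle L) (φ : BerkovichPSH.Metric π L) :
    φ.IsContinuousSemipositive ↔ φ.IsContinuousPSH := by
  exact ⟨fun h ↦ h.isContinuousPSH hvar hproj hL, fun h ↦ h.isContinuousSemipositive hvar hproj hL⟩
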